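/- **Setting.** Let $G$ be an amenable Hausdorff topological group acting jointly continuously (from the left) on a compact metric space $(X,d)$; amenable means that the bounded functions $a$ on $G$ with $\sup_h|a(vh)-a(h)|\to0$ as $v\to e$ carry a left invariant mean. $C(X)$ denotes the real continuous functions on $X$. A sequence $(F_n)$ of subsets of $G$ with a Borel measure $\theta$ on $G$ is a * *thick left (right) Følner sequence* if $G$ is locally compact, $\theta$ is a left (right) Haar measure, the $F_n$ are non-empty and compact with $\theta(F_n)>0$, and $\theta(F_n\triangle KF_n)/\theta(F_n)\to 0$ (respectively $\theta(F_n\triangle F_nK)/\theta(F_n)\to0$) for every non-empty compact $K\subseteq G$; * *thin left (right) Følner sequence* if $\theta$ is the counting measure, the $F_n$ are non-empty and finite, and $\mathfrak m_V(F_n,gF_n)/|F_n|\to1$ (respectively $\mathfrak m_V(F_n,F_ng)/|F_n|\to 1$) for all $g\in G$ and all open neighbourhoods $V$ of the neutral element, where $\mathfrak m_V(F,E)$ is the maximal cardinality of a set $M\subseteq F$ that admits an injection $\phi:M\to E$ with $\phi(f)\in Vf$ for all $f\in M$; * *mirrored thin right Følner sequence* if the same holds with $F_ng$ and with $\phi(f)\in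 fV$ in place of $\phi(f)\in Vf$. Let $S_n^* \delta_x$ be the image of $\theta|_{F_n}/\theta(F_n)$ under $g\mapsto gx$. The system is *$(F_n)$-weakly mean equicontinuous* if $(x,y)\mapsto\limsup_{n} W(S_n^*\delta_x,S_n^*\delta_y)$ is continuous on $X^2$, where $W(\mu,\nu)=\inf_\iota\int d\,d\iota$ is the Wasserstein distance, the infimum being over all couplings $\iota$ of $\mu$ and $\nu$. A point $x$ is *$\mu$-generic along $(F_n)$* if $\frac1{\theta(F_n)}\int_{F_n}f(gx)\,d\theta(g)\to\int f\,d\mu$ for all $f\in C(X)$. An orbit closure is *uniquely ergodic* if it carries exactly one $G$-invariant Borel probability measure. **Theorem.** Let $\mathcal F$ be a left or right Følner sequence of any of the above kinds. (1) If $(X,G)$ is $\mathcal F$-weakly mean equicontinuous, then there are a subsequence $(F_n)$ of $\mathcal F$ and a bounded linear operator $S:C(X)\to C(X)$ with $$\lim_{n\to\infty}\frac1{\theta(F_n)}\int_{F_n}f(gx)\,d\theta(g)=Sf(x)\qquad(f\in C(X),\ x\in X).\tag{$*$}$$ (2) Conversely, let $(F_n)$ be $\mathcal F$ or any subsequence of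 it, and let $S$ be a bounded linear operator on $C(X)$ satisfying $(*)$. Then $(X,G)$ is $(F_n)$-weakly mean equicontinuous; $S$ is positive and contractive ($Sf\ge0$ if $f\ge0$, $S\mathbf 1\le\mathbf 1$, $\|S\|\le1$); and every $x\in X$ is $\mu_x$-generic along $(F_n)$ for a Borel probability measure $\mu_x$ with $Sf(x)=\int f\,d\mu_x$ for all $f\in C(X)$, the map $x\mapsto\mu_x$ being weak*-continuous. (3) In the situation of (2), assume that $G$ is locally compact in case $\mathcal F$ is only a mirrored thin right Følner sequence. Then $S$ is moreover a projection, $S^2=S$, and * (a) $S(f\,Sh)=S(Sf\,Sh)$ for all $f,h\in C(X)$ (Seever's identity); * (b) $S(f\,Sh)=Sf\,Sh$ for all $f,h\in C(X)$ ($S$ is an averaging operator) if and only if $\mu_x$ is ($G$-invariant and) ergodic for every $x\in X$; * (c) $T_gS=S$ for all $g\in G$, where $T_gf(x)=f(gx)$, if and only if every orbit closure $\overline{Gx}$, $x\in X$, is uniquely ergodic. -/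

import Mathlib

open MeasureTheory Filter Topology
open scoped Pointwise symmDiff BoundedContinuousFunction

namespace FolnerAverages

noncomputable section

/-! ### Amenability and Følner sequences -/

section Group

variable {G : Type*} [Group G] [TopologicalSpace G]

/-- A bounded continuous function `a` on `G` is right uniformly continuous if `a (v * h)` is close
to `a h`, uniformly in `h`, for `v` close to the neutral element. -/
def IsRightUniformlyContinuous (a : G →ᵇ ℝ) : Prop :=
  ∀ ε > 0, ∃ V ∈ 𝓝 (1 : G), ∀ v ∈ V, ∀ h : G, |a (v * h) - a h| < ε

/-- A topological group is amenable if there is a left invariant mean on its right uniformly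
continuous bounded functions. (A mean on this subspace always extends to a positive normalized
functional on all bounded continuous functions; invariance is only asked on the subspace.) -/
def IsAmenable (G : Type*) [Group G] [TopologicalSpace G] [IsTopologicalGroup G] : Prop :=
  ∃ m : (G →ᵇ ℝ) →ₗ[ℝ] ℝ,
    (∀ a : G →ᵇ ℝ, 0 ≤ a → 0 ≤ m a) ∧ m 1 = 1 ∧
    ∀ a : G →ᵇ ℝ, IsRightUniformlyContinuous a →
      ∀ g : G, m (a.compContinuous ⟨fun h => g * h, continuous_const_mul g⟩) = m a

/-- `θ` is a (regular) left Haar measure. -/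
def IsLeftHaar [MeasurableSpace G] [BorelSpace G] (θ : Measure G) : Prop :=
  θ.Regular ∧ θ.IsOpenPosMeasure ∧ θ.IsMulLeftInvariant

/-- `θ` is a (regular) right Haar measure. -/
def IsRightHaar [MeasurableSpace G] [BorelSpace G] (θ : Measure G) : Prop :=
  θ.Regular ∧ θ.IsOpenPosMeasure ∧ θ.IsMulRightInvariant

/-- Thick left Følner sequences in a locally compact group, with `θ` a left Haar measure. -/
structure IsThickLeftFolner [MeasurableSpace G] [BorelSpace G]
    (θ : Measure G) (F : ℕ → Set G) : Prop where
  locallyCompact : LocallyCompactSpace G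
  haar : IsLeftHaar θ
  isCompact : ∀ n, IsCompact (F n)
  nonempty : ∀ n, (F n).Nonempty
  pos : ∀ n, 0 < θ (F n)
  tendsto : ∀ K : Set G, IsCompact K → K.Nonempty →
    Tendsto (fun n => θ (F n ∆ (K * F n)) / θ (F n)) atTop (𝓝 0)

/-- Thick right Følner sequences in a locally compact group, with `θ` a right Haar measure. -/
structure IsThickRightFolner [MeasurableSpace G] [BorelSpace G]
    (θ : Measure G) (F : ℕ → Set G) : Prop where
  locallyCompact : LocallyCompactSpace G
  haar : IsRightHaar θ
  isCompact : ∀ n, IsCompact (F n)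
  nonempty : ∀ n, (F n).Nonempty
  pos : ∀ n, 0 < θ (F n)
  tendsto : ∀ K : Set G, IsCompact K → K.Nonempty →
    Tendsto (fun n => θ (F n ∆ (F n * K)) / θ (F n)) atTop (𝓝 0)

/-- The `V`-matching number of (finite) sets `F` and `E`: the maximal cardinality of a subset
`M ⊆ F` with an injection `φ : M → E` such that `φ f ∈ V f` for all `f ∈ M`. -/
def matchingNumber (V F E : Set G) : ℕ :=
  sSup {k | ∃ M ⊆ F, M.ncard = k ∧ ∃ φ : G → G,
    Set.InjOn φ M ∧ Set.MapsTo φ M E ∧ ∀ f ∈ M, φ f ∈ V * {f}}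

/-- The mirrored `V`-matching number, where `φ f ∈ f V` instead of `φ f ∈ V f`. -/
def mirroredMatchingNumber (V F E : Set G) : ℕ :=
  sSup {k | ∃ M ⊆ F, M.ncard = k ∧ ∃ φ : G → G,
    Set.InjOn φ M ∧ Set.MapsTo φ M E ∧ ∀ f ∈ M, φ f ∈ ({f} : Set G) * V}

/-- Thin left Følner sequences; the measure used for averaging is the counting measure. -/
structure IsThinLeftFolner [MeasurableSpace G] (θ : Measure G) (F : ℕ → Set G) : Prop where
  count : θ = Measure.count
  finite : ∀ n, (F n).Finite
  nonempty : ∀ n, (F n).Nonempty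
  tendsto : ∀ g : G, ∀ V : Set G, IsOpen V → (1 : G) ∈ V →
    Tendsto (fun n => (matchingNumber V (F n) ({g} * F n) : ℝ) / ((F n).ncard : ℝ)) atTop (𝓝 1)

/-- Thin right Følner sequences: `F n` is matched with its right translates `F n * g`, matched
elements `f`, `φ f` satisfying `φ f ∈ V f`. -/
structure IsThinRightFolner [MeasurableSpace G] (θ : Measure G) (F : ℕ → Set G) : Prop where
  count : θ = Measure.count
  finite : ∀ n, (F n).Finite
  nonempty : ∀ n, (F n).Nonempty
  tendsto : ∀ g : G, ∀ V : Set G, IsOpen V → (1 : G) ∈ V →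
    Tendsto (fun n => (matchingNumber V (F n) (F n * {g}) : ℝ) / ((F n).ncard : ℝ)) atTop (𝓝 1)

/-- Mirrored thin right Følner sequences: `F n` is matched with its right translates `F n * g`,
matched elements `f`, `φ f` satisfying `φ f ∈ f V`. Equivalently, `(F n)⁻¹` is thin left Følner. -/
structure IsMirroredThinRightFolner [MeasurableSpace G] (θ : Measure G) (F : ℕ → Set G) :
    Prop where
  count : θ = Measure.count
  finite : ∀ n, (F n).Finite
  nonempty : ∀ n, (F n).Nonempty
  tendsto : ∀ g : G, ∀ V : Set G, IsOpen V → (1 : G) ∈ V →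
    Tendsto (fun n => (mirroredMatchingNumber V (F n) (F n * {g}) : ℝ) / ((F n).ncard : ℝ))
      atTop (𝓝 1)

/-- Left or right Følner sequences of any kind, together with the averaging measure `θ`. -/
def IsFolner [MeasurableSpace G] [BorelSpace G] (θ : Measure G) (F : ℕ → Set G) : Prop :=
  IsThickLeftFolner θ F ∨ IsThickRightFolner θ F ∨ IsThinLeftFolner θ F ∨
    IsThinRightFolner θ F ∨ IsMirroredThinRightFolner θ F

/-- Left or right Følner sequences, where mirrored thin right ones are only admitted in locally
compact groups: beyond those, their averages need not be asymptotically invariant. -/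
def IsAdmissibleFolner [MeasurableSpace G] [BorelSpace G] (θ : Measure G) (F : ℕ → Set G) : Prop :=
  IsThickLeftFolner θ F ∨ IsThickRightFolner θ F ∨ IsThinLeftFolner θ F ∨
    IsThinRightFolner θ F ∨ (IsMirroredThinRightFolner θ F ∧ LocallyCompactSpace G)

end Group

/-! ### The Wasserstein distance -/

/-- The Wasserstein distance: infimum of `∫ d dι` over all joinings `ι` of `μ` with `ν`. -/
def wasserstein {X : Type*} [MetricSpace X] [MeasurableSpace X] (μ ν : Measure X) : ℝ :=
  ⨅ ι : {ι : Measure (X × X) // ι.map Prod.fst = μ ∧ ι.map Prod.snd = ν},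
    ∫ p, dist p.1 p.2 ∂(ι : Measure (X × X))

/-! ### Averages along orbits -/

section System

variable {G X : Type*} [Group G] [TopologicalSpace G] [MeasurableSpace G]
  [MetricSpace X] [MulAction G X]

/-- `S_n f (x) = 1 / θ(F_n) * ∫_{F_n} f(g x) dθ(g)`. -/
def folnerAverage (θ : Measure G) (F : ℕ → Set G) (n : ℕ) (f : C(X, ℝ)) (x : X) : ℝ :=
  (θ.real (F n))⁻¹ * ∫ g in F n, f (g • x) ∂θ

/-- The measure `S_n^* δ_x`: the image of the normalized restriction of `θ` to `F_n` under
`g ↦ g x`. -/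
def orbitMeasure [MeasurableSpace X] (θ : Measure G) (F : ℕ → Set G) (n : ℕ) (x : X) : Measure X :=
  ((θ (F n))⁻¹ • θ.restrict (F n)).map (fun g => g • x)

/-- The pseudometric `limsup_n W(S_n^* δ_x, S_n^* δ_y)`. -/
def folnerPseudometric [MeasurableSpace X] (θ : Measure G) (F : ℕ → Set G) (x y : X) : ℝ :=
  limsup (fun n => wasserstein (orbitMeasure θ F n x) (orbitMeasure θ F n y)) atTop

/-- The system on `X` is weakly mean equicontinuous with respect to `F`. -/
def IsWeaklyMeanEquicontinuous (X : Type*) [MetricSpace X] [MulAction G X] [MeasurableSpace X]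
    (θ : Measure G) (F : ℕ → Set G) : Prop :=
  Continuous (fun p : X × X => folnerPseudometric θ F p.1 p.2)

/-- Pointwise convergence of the averages along `F` to the operator `S`. -/
def AveragesTendsto [CompactSpace X] (θ : Measure G) (F : ℕ → Set G)
    (S : C(X, ℝ) →L[ℝ] C(X, ℝ)) : Prop :=
  ∀ (f : C(X, ℝ)) (x : X), Tendsto (fun n => folnerAverage θ F n f x) atTop (𝓝 (S f x))

/-- The point `x` is `μ`-generic along `F`. -/
def IsGeneric [MeasurableSpace X] (θ : Measure G) (F : ℕ → Set G) (x : X) (μ : Measure X) : Prop :=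
  ∀ f : C(X, ℝ), Tendsto (fun n => folnerAverage θ F n f x) atTop (𝓝 (∫ y, f y ∂μ))

end System

/-- The Koopman operator `T_g f = f ∘ g`. -/
def koopman {G X : Type*} [Group G] [TopologicalSpace G] [TopologicalSpace X] [MulAction G X]
    [ContinuousSMul G X] (g : G) (f : C(X, ℝ)) : C(X, ℝ) :=
  f.comp ⟨fun x => g • x, continuous_const_smul g⟩

/-- The orbit closure of `x` is uniquely ergodic: it carries exactly one invariant Borel
probability measure. -/
def IsUniquelyErgodicOrbitClosure (G : Type*) {X : Type*} [Group G] [TopologicalSpace X]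
    [MulAction G X] [MeasurableSpace X] (x : X) : Prop :=
  ∃! μ : ProbabilityMeasure X,
    SMulInvariantMeasure G X (μ : Measure X) ∧
      (μ : Measure X) (closure (MulAction.orbit G x))ᶜ = 0

end

end FolnerAverages

/-!
Write `S_n f (x)` for the averages along `F`, the integral of `f` against `S_n^* δ_x`.

By Kantorovich duality the Wasserstein distance on a compact space is the supremum of
`∫ f dμ - ∫ f dν` over the 1-Lipschitz functions `f`; modulo constants these form a compact family,
so the distance is weak*-continuous. Every continuous `f` satisfies
`|f x - f y| ≤ ε + C d(x, y)` with `C` depending on `ε`, so weak mean equicontinuity makes `S_n f`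
equicontinuous up to finitely many `n`, and a diagonal argument on a dense set yields a convergent
subsequence. Conversely, the measures `S_n^* δ_x` converge weak* to the measures `μ_x` that
represent `S`, so their Wasserstein distances converge to `W(μ_x, μ_y)`.

For left Følner sequences the `μ_x` are invariant because `S_n (T_g f) - S_n f → 0`. For right ones
`S f` is constant on orbit closures; by amenability the orbit closure of `x` carries an invariant
measure, and this measure must be `μ_x` because `S` preserves its integral. So `S` is an idempotent
that contracts `∫ f² dν` for every invariant `ν`, that is, an orthogonal projection. This gives
Seever's identity, and it makes `S f` invariant `ν`-almost everywhere; `S` is averaging exactly when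
`S f` is `μ_x`-almost everywhere constant for all `f` and `x`, which is ergodicity of `μ_x`.
-/

namespace FolnerAverages

open scoped NNReal

/-! ### Measures and functionals on compact spaces -/

section Functionals

variable {Y : Type*} [TopologicalSpace Y] [MeasurableSpace Y] [BorelSpace Y]

lemma integrable_continuousMap [CompactSpace Y] (μ : Measure Y) [IsFiniteMeasure μ]
    (f : C(Y, ℝ)) : Integrable f μ :=
  f.continuous.integrable_of_hasCompactSupport (HasCompactSupport.of_compactSpace _)

theorem exists_measure_of_nonneg [CompactSpace Y] [T2Space Y] (Λ : C(Y, ℝ) →ₗ[ℝ] ℝ)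
    (hΛ : ∀ f, 0 ≤ f → 0 ≤ Λ f) :
    ∃ μ : Measure Y, IsFiniteMeasure μ ∧ ∀ f : C(Y, ℝ), ∫ y, f y ∂μ = Λ f := by
  let Λ₀ : CompactlySupportedContinuousMap Y ℝ →ₗ[ℝ] ℝ :=
    { toFun := fun f => Λ f.toContinuousMap
      map_add' := fun f g => Λ.map_add f.toContinuousMap g.toContinuousMap
      map_smul' := fun c f => Λ.map_smul c f.toContinuousMap }
  let Λ' := PositiveLinearMap.mk₀ Λ₀ fun f hf => hΛ f.toContinuousMap hf
  exact ⟨RealRMK.rieszMeasure Λ', inferInstance, fun f => RealRMK.integral_rieszMeasure Λ'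
    (CompactlySupportedContinuousMap.continuousMapEquiv f)⟩

theorem exists_probabilityMeasure_of_nonneg [CompactSpace Y] [T2Space Y] (Λ : C(Y, ℝ) →ₗ[ℝ] ℝ)
    (hΛ : ∀ f, 0 ≤ f → 0 ≤ Λ f) (h1 : Λ 1 = 1) :
    ∃ μ : ProbabilityMeasure Y, ∀ f : C(Y, ℝ), ∫ y, f y ∂(μ : Measure Y) = Λ f := by
  obtain ⟨μ, _, hμ⟩ := exists_measure_of_nonneg Λ hΛ
  have huniv : μ.real Set.univ = 1 := by simpa [h1] using hμ 1
  exact ⟨⟨μ, ⟨(ENNReal.toReal_eq_one_iff _).1 huniv⟩⟩, hμ⟩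

theorem measure_eq_of_forall_integral_eq [HasOuterApproxClosed Y] {μ ν : Measure Y}
    [IsFiniteMeasure μ] [IsFiniteMeasure ν]
    (h : ∀ f : C(Y, ℝ), ∫ y, f y ∂μ = ∫ y, f y ∂ν) : μ = ν :=
  ext_of_forall_integral_eq_of_IsFiniteMeasure fun f => h f.toContinuousMap

theorem tendsto_probabilityMeasure_iff [CompactSpace Y] {ι : Type*} {l : Filter ι}
    {μs : ι → ProbabilityMeasure Y} {μ : ProbabilityMeasure Y} :
    Tendsto μs l (𝓝 μ) ↔ ∀ f : C(Y, ℝ),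
      Tendsto (fun i => ∫ y, f y ∂(μs i : Measure Y)) l (𝓝 (∫ y, f y ∂(μ : Measure Y))) := by
  rw [ProbabilityMeasure.tendsto_iff_forall_integral_tendsto]
  exact ⟨fun h f => h (BoundedContinuousFunction.mkOfCompact f), fun h f => h f.toContinuousMap⟩

theorem measure_compl_eq_zero_of_forall_integral_eq_zero {X : Type*} [PseudoMetricSpace X]
    [CompactSpace X] [MeasurableSpace X] [BorelSpace X] {μ : Measure X} [IsFiniteMeasure μ]
    {C : Set X} (hC : IsClosed C) (hne : C.Nonempty)
    (h : ∀ f : C(X, ℝ), (∀ x ∈ C, f x = 0) → ∫ x, f x ∂μ = 0) : μ Cᶜ = 0 := by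
  let f : C(X, ℝ) := ⟨fun x => Metric.infDist x C, Metric.continuous_infDist_pt C⟩
  have hnonneg : 0 ≤ fun x => f x := fun x => Metric.infDist_nonneg (x := x)
  have hf : f =ᵐ[μ] 0 := (integral_eq_zero_iff_of_nonneg hnonneg (integrable_continuousMap μ f)).1
    (h f fun x hx => Metric.infDist_zero_of_mem hx)
  exact measure_mono_null (fun x hx hx0 => hx ((hC.mem_iff_infDist_zero hne).2 hx0)) hf

end Functionals

section Koopman

variable {G X : Type*} [Group G] [TopologicalSpace G] [TopologicalSpace X] [MulAction G X]
  [ContinuousSMul G X]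

@[simp]
lemma koopman_apply (g : G) (f : C(X, ℝ)) (x : X) : koopman g f x = f (g • x) := rfl

theorem smulInvariantMeasure_iff_integral_koopman [HasOuterApproxClosed X] [MeasurableSpace X]
    [BorelSpace X] (μ : Measure X) [IsFiniteMeasure μ] :
    SMulInvariantMeasure G X μ ↔
      ∀ (g : G) (f : C(X, ℝ)), ∫ x, koopman g f x ∂μ = ∫ x, f x ∂μ := by
  have integral_koopman (g : G) (f : C(X, ℝ)) :
      ∫ x, koopman g f x ∂μ = ∫ x, f x ∂μ.map (g • ·) :=
    (integral_map_of_stronglyMeasurable (continuous_const_smul g).measurable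
      f.continuous.stronglyMeasurable).symm
  refine ⟨fun _ g f => by rw [integral_koopman, (measurePreserving_smul g μ).map_eq],
    fun h => ⟨fun g s hs => ?_⟩⟩
  have hmap : μ.map (g • ·) = μ :=
    measure_eq_of_forall_integral_eq fun f => by rw [← integral_koopman, h]
  rw [← Measure.map_apply (continuous_const_smul g).measurable hs, hmap]

end Koopman

/-! ### Kantorovich duality -/

lemma nonempty_joining {X : Type*} [MeasurableSpace X] (μ ν : Measure X) [IsProbabilityMeasure μ]
    [IsProbabilityMeasure ν] :
    Nonempty {ι : Measure (X × X) // ι.map Prod.fst = μ ∧ ι.map Prod.snd = ν} :=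
  ⟨⟨μ.prod ν, by simp [Measure.map_fst_prod], by simp [Measure.map_snd_prod]⟩⟩

section Coupling

variable {X : Type*} [MetricSpace X] [MeasurableSpace X] {μ ν : Measure X}

lemma wasserstein_le_integral_dist {ι : Measure (X × X)} (h₁ : ι.map Prod.fst = μ)
    (h₂ : ι.map Prod.snd = ν) : wasserstein μ ν ≤ ∫ p, dist p.1 p.2 ∂ι :=
  ciInf_le (f := fun ι : {ι : Measure (X × X) // ι.map Prod.fst = μ ∧ ι.map Prod.snd = ν} =>
      ∫ p, dist p.1 p.2 ∂ι.1)
    ⟨0, Set.forall_mem_range.2 fun _ => integral_nonneg fun _ => dist_nonneg⟩ ⟨ι, h₁, h₂⟩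

lemma wasserstein_nonneg (μ ν : Measure X) : 0 ≤ wasserstein μ ν :=
  Real.iInf_nonneg fun _ => integral_nonneg fun _ => dist_nonneg

end Coupling

lemma exists_lipschitzWith_between {X : Type*} [PseudoMetricSpace X] {φ ψ : X → ℝ}
    {t : ℝ≥0} (h : ∀ x y, φ x ≤ ψ y + t * dist x y) :
    ∃ f : X → ℝ, LipschitzWith t f ∧ φ ≤ f ∧ f ≤ ψ := by
  have hbdd x : BddBelow (Set.range fun y => ψ y + t * dist x y) :=
    ⟨φ x, Set.forall_mem_range.2 (h x)⟩
  refine ⟨fun x => ⨅ y, (ψ y + t * dist x y), LipschitzWith.of_le_add_mul t fun x x' => ?_,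
    fun x => ?_, fun x => (ciInf_le (hbdd x) x).trans_eq (by simp)⟩ <;>
    have : Nonempty X := ⟨x⟩
  · rw [← sub_le_iff_le_add]
    refine le_ciInf fun y => ?_
    have hle : ⨅ y, (ψ y + t * dist x y) ≤ ψ y + t * dist x y := ciInf_le (hbdd x) y
    linarith [mul_le_mul_of_nonneg_left (dist_triangle x x' y) t.coe_nonneg]
  · exact le_ciInf (h x)

lemma integral_sub_integral_le_mul {X : Type*} [PseudoMetricSpace X] [MeasurableSpace X]
    {μ ν : Measure X} [IsProbabilityMeasure μ] [IsProbabilityMeasure ν] {K : ℝ}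
    (hK : ∀ f : C(X, ℝ), LipschitzWith 1 f → ∫ x, f x ∂μ - ∫ x, f x ∂ν ≤ K)
    {t : ℝ≥0} {f : C(X, ℝ)} (hf : LipschitzWith t f) :
    ∫ x, f x ∂μ - ∫ x, f x ∂ν ≤ K * t := by
  rcases eq_or_ne t 0 with rfl | ht
  · obtain ⟨x₀⟩ := nonempty_of_isProbabilityMeasure μ
    simp [fun x => (LipschitzWith.zero_iff f).1 hf x x₀]
  · have hscale : LipschitzWith 1 ((t : ℝ)⁻¹ • f) := by
      have := (lipschitzWith_smul (β := ℝ) (t : ℝ)⁻¹).comp hf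
      rw [nnnorm_inv, NNReal.nnnorm_eq, inv_mul_cancel₀ ht] at this
      exact this
    have hle := hK _ hscale
    simp only [ContinuousMap.smul_apply, smul_eq_mul, integral_const_mul] at hle
    rwa [← mul_sub, inv_mul_le_iff₀ (by positivity), mul_comm] at hle

theorem exists_linearMap_le_of_pointedCone {E : Type*} [AddCommGroup E] [Module ℝ E]
    (s : PointedCone ℝ (E × ℝ)) (hpos : ∀ r, ((0 : E), r) ∈ s → 0 ≤ r)
    (hdom : ∀ u, ∃ r, (u, r) ∈ s) : ∃ Λ : E →ₗ[ℝ] ℝ, ∀ u r, (u, r) ∈ s → Λ u ≤ r := by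
  obtain ⟨g, hg, hgs⟩ := riesz_extension s
    ((LinearMap.snd ℝ E ℝ).toPMap (Submodule.prod ⊥ ⊤))
    (by
      rintro ⟨⟨u, r⟩, hu⟩ hur
      obtain rfl : u = 0 := hu.1
      exact hpos r hur)
    (by
      rintro ⟨u, r⟩
      obtain ⟨r', hr'⟩ := hdom u
      exact ⟨⟨(0, r' - r), by simp, by simp⟩, by simpa using hr'⟩)
  have hgr (r : ℝ) : g (0, r) = r := hg ⟨(0, r), by simp, by simp⟩
  refine ⟨-(g ∘ₗ LinearMap.inl ℝ E ℝ), fun u r hur => ?_⟩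
  have hsum : 0 ≤ g (u, 0) + g (0, r) := by
    rw [← map_add, Prod.mk_add_mk, add_zero, zero_add]
    exact hgs _ hur
  rw [hgr] at hsum
  exact neg_le_iff_add_nonneg'.2 hsum

theorem map_eq_of_forall_integral_comp_le {Y Z : Type*} [TopologicalSpace Y] [CompactSpace Y]
    [MeasurableSpace Y] [BorelSpace Y] [TopologicalSpace Z] [HasOuterApproxClosed Z]
    [MeasurableSpace Z] [BorelSpace Z] {ι : Measure Y} {μ : Measure Z} [IsFiniteMeasure ι]
    [IsFiniteMeasure μ] (p : C(Y, Z))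
    (h : ∀ f : C(Z, ℝ), ∫ y, f (p y) ∂ι ≤ ∫ z, f z ∂μ) : ι.map p = μ := by
  refine measure_eq_of_forall_integral_eq fun f => ?_
  rw [integral_map_of_stronglyMeasurable p.continuous.measurable f.continuous.stronglyMeasurable]
  have hneg := h (-f)
  simp only [ContinuousMap.neg_apply, integral_neg, neg_le_neg_iff] at hneg
  exact le_antisymm (h f) hneg

section Duality

variable {X : Type*} [MetricSpace X] [CompactSpace X] [MeasurableSpace X] [BorelSpace X]
  {μ ν : Measure X} [IsProbabilityMeasure μ] [IsProbabilityMeasure ν]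

lemma integrable_dist (ι : Measure (X × X)) [IsFiniteMeasure ι] :
    Integrable (fun p : X × X => dist p.1 p.2) ι :=
  integrable_continuousMap ι ⟨fun p : X × X => dist p.1 p.2, continuous_dist⟩

theorem abs_integral_sub_integral_le {f : C(X, ℝ)} {ε C : ℝ} (hC : 0 ≤ C)
    (hf : ∀ x y, |f x - f y| ≤ ε + C * dist x y) :
    |∫ x, f x ∂μ - ∫ x, f x ∂ν| ≤ ε + C * wasserstein μ ν := by
  have := nonempty_joining μ ν
  rw [← sub_le_iff_le_add', wasserstein, Real.mul_iInf_of_nonneg hC]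
  refine le_ciInf fun ⟨ι, hfst, hsnd⟩ => ?_
  have : IsProbabilityMeasure (ι.map Prod.fst) := hfst ▸ ‹IsProbabilityMeasure μ›
  have : IsProbabilityMeasure ι := Measure.isProbabilityMeasure_of_map Prod.fst
  have hint₁ : Integrable (fun p => f p.1) ι :=
    integrable_continuousMap ι (f.comp ⟨Prod.fst, continuous_fst⟩)
  have hint₂ : Integrable (fun p => f p.2) ι :=
    integrable_continuousMap ι (f.comp ⟨Prod.snd, continuous_snd⟩)
  rw [sub_le_iff_le_add']
  calc |∫ x, f x ∂μ - ∫ x, f x ∂ν| = |∫ p, (f p.1 - f p.2) ∂ι| := by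
        rw [integral_sub hint₁ hint₂, ← hfst, ← hsnd,
          integral_map_of_stronglyMeasurable measurable_fst f.continuous.stronglyMeasurable,
          integral_map_of_stronglyMeasurable measurable_snd f.continuous.stronglyMeasurable]
    _ ≤ ∫ p, |f p.1 - f p.2| ∂ι := abs_integral_le_integral_abs
    _ ≤ ∫ p, (ε + C * dist p.1 p.2) ∂ι :=
        integral_mono (hint₁.sub hint₂).abs
          ((integrable_const ε).add ((integrable_dist ι).const_mul C)) fun p => hf p.1 p.2
    _ = ε + C * ∫ p, dist p.1 p.2 ∂ι := by
        rw [integral_add (integrable_const ε) ((integrable_dist ι).const_mul C),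
          integral_const_mul, integral_const, probReal_univ, one_smul]

lemma integral_sub_integral_le_wasserstein {f : C(X, ℝ)} (hf : LipschitzWith 1 f) :
    ∫ x, f x ∂μ - ∫ x, f x ∂ν ≤ wasserstein μ ν := by
  refine (le_abs_self _).trans ?_
  simpa using abs_integral_sub_integral_le (μ := μ) (ν := ν) (ε := 0) zero_le_one fun x y => by
    simpa [Real.dist_eq] using hf.dist_le_mul x y

lemma integral_add_integral_add_mul_nonneg {K : ℝ}
    (hK : ∀ f : C(X, ℝ), LipschitzWith 1 f → ∫ x, f x ∂μ - ∫ x, f x ∂ν ≤ K)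
    {φ ψ : C(X, ℝ)} {t : ℝ≥0} (h : ∀ x y, 0 ≤ φ x + ψ y + t * dist x y) :
    0 ≤ ∫ x, φ x ∂μ + ∫ x, ψ x ∂ν + K * t := by
  obtain ⟨f, hf, hφf, hfψ⟩ := exists_lipschitzWith_between (φ := fun x => -φ x) (ψ := ψ) (t := t)
    fun x y => by linarith [h x y]
  lift f to C(X, ℝ) using hf.continuous
  have hμ : -∫ x, φ x ∂μ ≤ ∫ x, f x ∂μ := by
    rw [← integral_neg]
    exact integral_mono (integrable_continuousMap μ φ).neg (integrable_continuousMap μ f) hφf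
  have hν : ∫ x, f x ∂ν ≤ ∫ x, ψ x ∂ν :=
    integral_mono (integrable_continuousMap ν f) (integrable_continuousMap ν ψ) hfψ
  linarith [integral_sub_integral_le_mul hK hf]

/-- The cone of pairs `(u, r)` for which `u` is dominated by a function
`(x, y) ↦ φ x + ψ y + t * dist x y` with `0 ≤ t` and `∫ φ dμ + ∫ ψ dν + K * t ≤ r`. Linear
functionals below this cone correspond to joinings of `μ` and `ν` with transport cost at most
`K`. -/
def transportCone (μ ν : Measure X) [IsFiniteMeasure μ] [IsFiniteMeasure ν] (K : ℝ) :
    PointedCone ℝ (C(X × X, ℝ) × ℝ) where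
  carrier := {p | ∃ (φ ψ : C(X, ℝ)) (t : ℝ≥0),
    (∀ x y, p.1 (x, y) ≤ φ x + ψ y + t * dist x y) ∧ ∫ x, φ x ∂μ + ∫ x, ψ x ∂ν + K * t ≤ p.2}
  zero_mem' := ⟨0, 0, 0, by simp, by simp⟩
  add_mem' := by
    rintro ⟨u, r⟩ ⟨u', r'⟩ ⟨φ, ψ, t, hu, hr⟩ ⟨φ', ψ', t', hu', hr'⟩
    refine ⟨φ + φ', ψ + ψ', t + t', fun x y => ?_, ?_⟩
    · simp only [Prod.mk_add_mk, ContinuousMap.add_apply, NNReal.coe_add]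
      linarith [hu x y, hu' x y]
    · simp only [Prod.mk_add_mk, ContinuousMap.add_apply, NNReal.coe_add]
      rw [integral_add (integrable_continuousMap μ φ) (integrable_continuousMap μ φ'),
        integral_add (integrable_continuousMap ν ψ) (integrable_continuousMap ν ψ')]
      linarith
  smul_mem' := by
    rintro (c : ℝ≥0) ⟨u, r⟩ ⟨φ, ψ, t, hu, hr⟩
    refine ⟨c • φ, c • ψ, c * t, fun x y => ?_, ?_⟩
    · change c * u (x, y) ≤ c * φ x + c * ψ y + (c * t : ℝ≥0) * dist x y
      rw [NNReal.coe_mul, mul_assoc, ← mul_add, ← mul_add]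
      exact mul_le_mul_of_nonneg_left (hu x y) c.coe_nonneg
    · change ∫ x, c * φ x ∂μ + ∫ x, c * ψ x ∂ν + K * (c * t : ℝ≥0) ≤ c * r
      rw [integral_const_mul, integral_const_mul, NNReal.coe_mul, mul_left_comm, ← mul_add,
        ← mul_add]
      exact mul_le_mul_of_nonneg_left hr c.coe_nonneg

theorem wasserstein_le_of_forall_lipschitzWith {K : ℝ}
    (hK : ∀ f : C(X, ℝ), LipschitzWith 1 f → ∫ x, f x ∂μ - ∫ x, f x ∂ν ≤ K) :
    wasserstein μ ν ≤ K := by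
  obtain ⟨Λ, hΛ⟩ := exists_linearMap_le_of_pointedCone (transportCone μ ν K)
    (fun r ⟨φ, ψ, t, hu, hr⟩ => (integral_add_integral_add_mul_nonneg hK hu).trans hr)
    (fun u => ⟨‖u‖, .const X ‖u‖, 0, 0,
      fun x y => by simpa using (le_abs_self _).trans (u.norm_coe_le_norm (x, y)), by simp⟩)
  have hΛ_nonneg (u : C(X × X, ℝ)) (hu : 0 ≤ u) : 0 ≤ Λ u := by
    have := hΛ (-u) 0 ⟨0, 0, 0, fun x y => by simpa using hu (x, y), by simp⟩
    rwa [map_neg, neg_nonpos] at this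
  obtain ⟨ι, _, hι⟩ := exists_measure_of_nonneg Λ hΛ_nonneg
  have hfst : ι.map Prod.fst = μ := map_eq_of_forall_integral_comp_le .fst fun f =>
    (hι (f.comp .fst)).trans_le (hΛ _ _ ⟨f, 0, 0, fun x y => by simp, by simp⟩)
  have hsnd : ι.map Prod.snd = ν := map_eq_of_forall_integral_comp_le .snd fun f =>
    (hι (f.comp .snd)).trans_le (hΛ _ _ ⟨0, f, 0, fun x y => by simp, by simp⟩)
  calc wasserstein μ ν ≤ ∫ p, dist p.1 p.2 ∂ι := wasserstein_le_integral_dist hfst hsnd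
    _ = Λ ⟨fun p => dist p.1 p.2, continuous_dist⟩ :=
        hι ⟨fun p => dist p.1 p.2, continuous_dist⟩
    _ ≤ K := hΛ _ _ ⟨0, 0, 1, fun x y => by simp, by simp⟩

lemma wasserstein_self : wasserstein μ μ = 0 :=
  (wasserstein_le_of_forall_lipschitzWith fun _ _ => (sub_self _).le).antisymm
    (wasserstein_nonneg μ μ)

lemma wasserstein_le_diam : wasserstein μ ν ≤ Metric.diam (Set.univ : Set X) := by
  have hdist (p : X × X) : dist p.1 p.2 ≤ Metric.diam (Set.univ : Set X) :=
    Metric.dist_le_diam_of_mem isCompact_univ.isBounded (Set.mem_univ _) (Set.mem_univ _)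
  calc wasserstein μ ν ≤ ∫ p, dist p.1 p.2 ∂μ.prod ν :=
        wasserstein_le_integral_dist (by simp [Measure.map_fst_prod])
          (by simp [Measure.map_snd_prod])
    _ ≤ ∫ _, Metric.diam (Set.univ : Set X) ∂μ.prod ν :=
        integral_mono (integrable_dist _) (integrable_const _) hdist
    _ = Metric.diam (Set.univ : Set X) := by simp

end Duality

theorem isCompact_setOf_lipschitzWith {X Y : Type*} [PseudoMetricSpace X] [CompactSpace X]
    [MetricSpace Y] (K : ℝ≥0) {Q : Set Y} (hQ : IsCompact Q) :
    IsCompact {f : C(X, Y) | LipschitzWith K f ∧ ∀ x, f x ∈ Q} := by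
  refine ArzelaAscoli.isCompact_of_equicontinuous _ ?_
    (LipschitzWith.uniformEquicontinuous _ K fun f => f.2.1).equicontinuous
  have himage : ContinuousMap.toFun '' {f : C(X, Y) | LipschitzWith K f ∧ ∀ x, f x ∈ Q} =
      {f | LipschitzWith K f} ∩ Set.univ.pi fun _ => Q := by
    ext f
    refine ⟨?_, fun ⟨hf, hfQ⟩ => ⟨⟨f, hf.continuous⟩, ⟨hf, fun x => hfQ x trivial⟩, rfl⟩⟩
    rintro ⟨f, ⟨hf, hfQ⟩, rfl⟩
    exact ⟨hf, fun x _ => hfQ x⟩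
  rw [himage]
  exact (isCompact_univ_pi fun _ => hQ).inter_left (isClosed_setOfPred_lipschitzWith K)

lemma dist_integral_le_dist {X : Type*} [TopologicalSpace X] [CompactSpace X] [MeasurableSpace X]
    [BorelSpace X] (μ : Measure X) [IsProbabilityMeasure μ] (f g : C(X, ℝ)) :
    dist (∫ x, f x ∂μ) (∫ x, g x ∂μ) ≤ dist f g := by
  rw [dist_eq_norm, ← integral_sub (integrable_continuousMap μ f) (integrable_continuousMap μ g)]
  have hle (x : X) : ‖f x - g x‖ ≤ dist f g :=
    (dist_eq_norm _ _).symm.trans_le (ContinuousMap.dist_apply_le_dist x)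
  simpa using norm_integral_le_of_norm_le_const (μ := μ) (Eventually.of_forall hle)

lemma continuous_integral_probabilityMeasure {X : Type*} [TopologicalSpace X] [CompactSpace X]
    [MeasurableSpace X] [BorelSpace X] :
    Continuous fun p : ProbabilityMeasure X × C(X, ℝ) => ∫ x, p.2 x ∂(p.1 : Measure X) :=
  continuous_prod_of_continuous_lipschitzWith' _ 1
    (fun μ => LipschitzWith.of_dist_le_mul fun f g => by
      simpa using dist_integral_le_dist (μ : Measure X) f g)
    fun f => ProbabilityMeasure.continuous_integral_boundedContinuousFunction (.mkOfCompact f)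

section Continuity

variable {X : Type*} [MetricSpace X] [CompactSpace X] [MeasurableSpace X] [BorelSpace X]

theorem wasserstein_eq_sSup (μ ν : Measure X) [IsProbabilityMeasure μ] [IsProbabilityMeasure ν] :
    wasserstein μ ν = sSup ((fun f : C(X, ℝ) => ∫ x, f x ∂μ - ∫ x, f x ∂ν) ''
      {f | LipschitzWith 1 f ∧
        ∀ x, f x ∈ Metric.closedBall 0 (Metric.diam (Set.univ : Set X))}) := by
  obtain ⟨x₀⟩ := nonempty_of_isProbabilityMeasure μ
  refine le_antisymm (wasserstein_le_of_forall_lipschitzWith fun f hf => ?_)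
    (csSup_le ⟨_, 0, ⟨LipschitzWith.const' 0, by simp [Metric.diam_nonneg]⟩, rfl⟩ ?_)
  · have hint (ρ : Measure X) [IsProbabilityMeasure ρ] :
        ∫ x, (f x - f x₀) ∂ρ = ∫ x, f x ∂ρ - f x₀ := by
      rw [integral_sub (integrable_continuousMap ρ f) (integrable_const _)]
      simp
    refine le_csSup ⟨wasserstein μ ν, ?_⟩ ⟨f - .const X (f x₀), ⟨?_, fun x => ?_⟩, ?_⟩
    · rintro _ ⟨g, hg, rfl⟩
      exact integral_sub_integral_le_wasserstein hg.1
    · have hsub := hf.sub (LipschitzWith.const (α := X) (f x₀))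
      rwa [add_zero] at hsub
    · calc dist (f x - f x₀) 0 = dist (f x) (f x₀) := by simp [Real.dist_eq]
        _ ≤ dist x x₀ := by simpa using hf.dist_le_mul x x₀
        _ ≤ Metric.diam Set.univ :=
          Metric.dist_le_diam_of_mem isCompact_univ.isBounded (Set.mem_univ _) (Set.mem_univ _)
    · simp [hint]
  · rintro _ ⟨f, hf, rfl⟩
    exact integral_sub_integral_le_wasserstein hf.1

theorem continuous_wasserstein : Continuous fun p : ProbabilityMeasure X × ProbabilityMeasure X =>
    wasserstein (p.1 : Measure X) (p.2 : Measure X) := by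
  simp_rw [wasserstein_eq_sSup]
  refine (isCompact_setOf_lipschitzWith 1 (isCompact_closedBall 0 _)).continuous_sSup ?_
  have hint := continuous_integral_probabilityMeasure (X := X)
  exact (hint.comp (continuous_fst.fst.prodMk continuous_snd)).sub
    (hint.comp (continuous_fst.snd.prodMk continuous_snd))

end Continuity

section AsymptoticEquicontinuity

variable {Z β : Type*} [TopologicalSpace Z] [PseudoMetricSpace β] {a : ℕ → Z → β}

/-- Equicontinuity of a sequence of maps up to finitely many members, which may depend on the
point at which the value at `z` is compared. -/
def AsymptoticallyEquicontinuous (a : ℕ → Z → β) : Prop :=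
  ∀ z, ∀ ε > 0, ∀ᶠ z' in 𝓝 z, ∀ᶠ n in atTop, dist (a n z) (a n z') < ε

lemma AsymptoticallyEquicontinuous.comp (h : AsymptoticallyEquicontinuous a) {φ : ℕ → ℕ}
    (hφ : StrictMono φ) : AsymptoticallyEquicontinuous (a ∘ φ) := fun z ε hε =>
  (h z ε hε).mono fun _ hz' => hφ.tendsto_atTop.eventually hz'

lemma AsymptoticallyEquicontinuous.cauchySeq_of_dense (h : AsymptoticallyEquicontinuous a)
    {D : Set Z} (hD : Dense D) (hlim : ∀ z ∈ D, CauchySeq fun n => a n z) (z : Z) :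
    CauchySeq fun n => a n z := by
  refine Metric.cauchySeq_iff.2 fun ε hε => ?_
  obtain ⟨z', hz'D, hz'⟩ := hD.inter_nhds_nonempty (h z (ε / 3) (by positivity))
  obtain ⟨N₁, hN₁⟩ := eventually_atTop.1 hz'
  obtain ⟨N₂, hN₂⟩ := Metric.cauchySeq_iff.1 (hlim z' hz'D) (ε / 3) (by positivity)
  refine ⟨max N₁ N₂, fun m hm n hn => ?_⟩
  rw [ge_iff_le, max_le_iff] at hm hn
  calc dist (a m z) (a n z)
      ≤ dist (a m z) (a m z') + dist (a m z') (a n z') + dist (a n z') (a n z) :=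
        dist_triangle4 _ _ _ _
    _ < ε / 3 + ε / 3 + ε / 3 := by
        rw [dist_comm (a n z')]
        exact add_lt_add (add_lt_add (hN₁ m hm.1) (hN₂ m hm.2 n hn.2)) (hN₁ n hn.1)
    _ = ε := by ring

lemma AsymptoticallyEquicontinuous.continuous_of_tendsto (h : AsymptoticallyEquicontinuous a)
    {L : Z → β} (hL : ∀ z, Tendsto (fun n => a n z) atTop (𝓝 (L z))) : Continuous L := by
  refine continuous_iff_continuousAt.2 fun z => Metric.tendsto_nhds.2 fun ε hε => ?_
  filter_upwards [h z (ε / 2) (half_pos hε)] with z' hz'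
  rw [dist_comm]
  exact (le_of_tendsto ((hL z).dist (hL z')) (hz'.mono fun _ => le_of_lt)).trans_lt
    (half_lt_self hε)

lemma exists_subseq_tendsto_of_countable {Z : Type*} [ProperSpace β] {a : ℕ → Z → β} {D : Set Z}
    (hD : D.Countable) (hbdd : ∀ z, Bornology.IsBounded (Set.range fun n => a n z)) :
    ∃ φ : ℕ → ℕ, StrictMono φ ∧ ∀ z ∈ D, ∃ l, Tendsto (fun n => a (φ n) z) atTop (𝓝 l) := by
  have := hD.to_subtype
  have hcompact : IsCompact (Set.univ.pi fun z : D => closure (Set.range fun n => a n z)) :=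
    isCompact_univ_pi fun z => (hbdd z).isCompact_closure
  obtain ⟨l, -, φ, hφ, hlim⟩ := hcompact.tendsto_subseq (x := fun n (z : D) => a n z)
    fun n z _ => subset_closure ⟨n, rfl⟩
  exact ⟨φ, hφ, fun z hz => ⟨l ⟨z, hz⟩, tendsto_pi_nhds.1 hlim ⟨z, hz⟩⟩⟩

theorem AsymptoticallyEquicontinuous.exists_subseq_tendsto [TopologicalSpace.SeparableSpace Z]
    [ProperSpace β] (h : AsymptoticallyEquicontinuous a)
    (hbdd : ∀ z, Bornology.IsBounded (Set.range fun n => a n z)) :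
    ∃ (φ : ℕ → ℕ) (L : Z → β), StrictMono φ ∧ Continuous L ∧
      ∀ z, Tendsto (fun n => a (φ n) z) atTop (𝓝 (L z)) := by
  obtain ⟨D, hD, hdense⟩ := TopologicalSpace.exists_countable_dense Z
  obtain ⟨φ, hφ, hlim⟩ := exists_subseq_tendsto_of_countable hD hbdd
  choose L hL using fun z => cauchySeq_tendsto_of_complete
    ((h.comp hφ).cauchySeq_of_dense hdense (fun z hz => (hlim z hz).choose_spec.cauchySeq) z)
  exact ⟨φ, L, hφ, (h.comp hφ).continuous_of_tendsto hL, hL⟩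

end AsymptoticEquicontinuity

/-! ### Averages along orbits -/

/-- The sets `F n` are measurable and have finite positive measure. -/
structure IsAveraging {G : Type*} [MeasurableSpace G] (θ : Measure G) (F : ℕ → Set G) : Prop where
  measurableSet : ∀ n, MeasurableSet (F n)
  ne_zero : ∀ n, θ (F n) ≠ 0
  ne_top : ∀ n, θ (F n) ≠ ⊤

namespace IsAveraging

variable {G : Type*} [MeasurableSpace G] {θ : Measure G} {F : ℕ → Set G}

lemma comp (hF : IsAveraging θ F) (φ : ℕ → ℕ) : IsAveraging θ (F ∘ φ) :=
  ⟨fun n => hF.measurableSet (φ n), fun n => hF.ne_zero (φ n), fun n => hF.ne_top (φ n)⟩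

lemma isFiniteMeasure_restrict (hF : IsAveraging θ F) (n : ℕ) :
    IsFiniteMeasure (θ.restrict (F n)) :=
  MeasureTheory.isFiniteMeasure_restrict.2 (hF.ne_top n)

lemma real_pos (hF : IsAveraging θ F) (n : ℕ) : 0 < θ.real (F n) :=
  ENNReal.toReal_pos (hF.ne_zero n) (hF.ne_top n)

end IsAveraging

section OrbitMeasure

variable {G X : Type*} [Group G] [TopologicalSpace G] [MeasurableSpace G] [BorelSpace G]
  [MetricSpace X] [MeasurableSpace X] [BorelSpace X] [MulAction G X] [ContinuousSMul G X]
  {θ : Measure G} {F : ℕ → Set G}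

lemma measurable_smul_left (x : X) : Measurable fun g : G => g • x :=
  (continuous_id.smul continuous_const).measurable

lemma IsAveraging.isProbabilityMeasure_orbitMeasure (hF : IsAveraging θ F) (n : ℕ) (x : X) :
    IsProbabilityMeasure (orbitMeasure θ F n x) := by
  have : IsProbabilityMeasure ((θ (F n))⁻¹ • θ.restrict (F n)) :=
    ⟨by simp [ENNReal.inv_mul_cancel (hF.ne_zero n) (hF.ne_top n)]⟩
  exact Measure.isProbabilityMeasure_map (measurable_smul_left x).aemeasurable

lemma integral_orbitMeasure (n : ℕ) (f : C(X, ℝ)) (x : X) :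
    ∫ y, f y ∂orbitMeasure θ F n x = folnerAverage θ F n f x := by
  rw [orbitMeasure, integral_map_of_stronglyMeasurable (measurable_smul_left x)
    f.continuous.stronglyMeasurable, integral_smul_measure, ENNReal.toReal_inv, smul_eq_mul]
  rfl

lemma folnerAverage_one (hF : IsAveraging θ F) (n : ℕ) (x : X) :
    folnerAverage θ F n 1 x = 1 := by
  have := hF.isProbabilityMeasure_orbitMeasure n x
  simp [← integral_orbitMeasure]

lemma folnerAverage_smul (n : ℕ) (c : ℝ) (f : C(X, ℝ)) (x : X) :
    folnerAverage θ F n (c • f) x = c • folnerAverage θ F n f x := by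
  simp only [← integral_orbitMeasure, ContinuousMap.smul_apply, integral_smul]

end OrbitMeasure

lemma exists_dist_le_add_mul_dist {X Y : Type*} [PseudoMetricSpace X] [CompactSpace X]
    [PseudoMetricSpace Y] (f : C(X, Y)) {ε : ℝ} (hε : 0 < ε) :
    ∃ C > 0, ∀ x y, dist (f x) (f y) ≤ ε + C * dist x y := by
  obtain ⟨δ, hδ, hf⟩ := Metric.uniformContinuous_iff.1
    (CompactSpace.uniformContinuous_of_continuous f.continuous) ε hε
  obtain ⟨D, hD⟩ := Metric.isBounded_range_iff.1 (isCompact_range f.continuous).isBounded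
  have hC : 0 < (|D| + 1) / δ := by positivity
  refine ⟨(|D| + 1) / δ, hC, fun x y => ?_⟩
  rcases lt_or_ge (dist x y) δ with h | h
  · exact (hf h).le.trans (le_add_of_nonneg_right (by positivity))
  · calc dist (f x) (f y) ≤ |D| + 1 := by linarith [hD x y, le_abs_self D]
      _ = (|D| + 1) / δ * δ := (div_mul_cancel₀ _ hδ.ne').symm
      _ ≤ (|D| + 1) / δ * dist x y := by gcongr
      _ ≤ ε + (|D| + 1) / δ * dist x y := le_add_of_nonneg_left hε.le

section Averages

variable {G X : Type*} [Group G] [TopologicalSpace G] [MeasurableSpace G] [BorelSpace G]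
  [MetricSpace X] [CompactSpace X] [MeasurableSpace X] [BorelSpace X] [MulAction G X]
  [ContinuousSMul G X] {θ : Measure G} {F : ℕ → Set G}

lemma dist_folnerAverage_le (hF : IsAveraging θ F) (n : ℕ) (f h : C(X, ℝ)) (x : X) :
    dist (folnerAverage θ F n f x) (folnerAverage θ F n h x) ≤ dist f h := by
  have := hF.isProbabilityMeasure_orbitMeasure n x
  simpa only [integral_orbitMeasure] using dist_integral_le_dist (orbitMeasure θ F n x) f h

lemma norm_folnerAverage_le (hF : IsAveraging θ F) (n : ℕ) (f : C(X, ℝ)) (x : X) :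
    ‖folnerAverage θ F n f x‖ ≤ ‖f‖ := by
  simpa [folnerAverage] using dist_folnerAverage_le hF n f 0 x

lemma folnerAverage_add (hF : IsAveraging θ F) (n : ℕ) (f h : C(X, ℝ)) (x : X) :
    folnerAverage θ F n (f + h) x = folnerAverage θ F n f x + folnerAverage θ F n h x := by
  have := hF.isProbabilityMeasure_orbitMeasure n x
  simp only [← integral_orbitMeasure, ContinuousMap.add_apply]
  exact integral_add (integrable_continuousMap _ f) (integrable_continuousMap _ h)

lemma exists_continuousLinearMap_of_tendsto (hF : IsAveraging θ F) {L : C(X, ℝ) → X → ℝ}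
    (hcont : ∀ f, Continuous (L f))
    (hL : ∀ f x, Tendsto (fun n => folnerAverage θ F n f x) atTop (𝓝 (L f x))) :
    ∃ S : C(X, ℝ) →L[ℝ] C(X, ℝ), AveragesTendsto θ F S := by
  let S₀ : C(X, ℝ) →ₗ[ℝ] C(X, ℝ) :=
    { toFun := fun f => ⟨L f, hcont f⟩
      map_add' := fun f h => ContinuousMap.ext fun x => tendsto_nhds_unique (hL (f + h) x)
        (((hL f x).add (hL h x)).congr fun n => (folnerAverage_add hF n f h x).symm)
      map_smul' := fun c f => ContinuousMap.ext fun x => tendsto_nhds_unique (hL (c • f) x)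
        (((hL f x).const_smul c).congr fun n => (folnerAverage_smul n c f x).symm) }
  refine ⟨S₀.mkContinuous 1 fun f => ?_, hL⟩
  rw [one_mul, ContinuousMap.norm_le _ (norm_nonneg f)]
  exact fun x => le_of_tendsto' (hL f x).norm fun n => norm_folnerAverage_le hF n f x

/-! ### Weak mean equicontinuity -/

lemma folnerPseudometric_self (hF : IsAveraging θ F) (x : X) : folnerPseudometric θ F x x = 0 := by
  have (n : ℕ) : wasserstein (orbitMeasure θ F n x) (orbitMeasure θ F n x) = 0 :=
    have := hF.isProbabilityMeasure_orbitMeasure n x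
    wasserstein_self
  simp [folnerPseudometric, this]

lemma IsWeaklyMeanEquicontinuous.asymptoticallyEquicontinuous (hF : IsAveraging θ F)
    (h : IsWeaklyMeanEquicontinuous X θ F) (f : C(X, ℝ)) :
    AsymptoticallyEquicontinuous fun n x => folnerAverage θ F n f x := by
  intro x ε hε
  obtain ⟨C, hC, hf⟩ := exists_dist_le_add_mul_dist f (half_pos hε)
  have hpair : Continuous fun p : X × X => folnerPseudometric θ F p.1 p.2 := h
  have hcont : Continuous (folnerPseudometric θ F x) := hpair.along_snd
  have hprob (n : ℕ) (z : X) : IsProbabilityMeasure (orbitMeasure θ F n z) :=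
    hF.isProbabilityMeasure_orbitMeasure n z
  have hnear : ∀ᶠ y in 𝓝 x, folnerPseudometric θ F x y < ε / 2 / C :=
    hcont.continuousAt.eventually_lt_const (by rw [folnerPseudometric_self hF]; positivity)
  refine hnear.mono fun y hy => ?_
  have hbdd : IsBoundedUnder (· ≤ ·) atTop
      fun n => wasserstein (orbitMeasure θ F n x) (orbitMeasure θ F n y) :=
    isBoundedUnder_of ⟨Metric.diam (Set.univ : Set X), fun n =>
      have := hprob n x
      have := hprob n y
      wasserstein_le_diam⟩
  refine (eventually_lt_of_limsup_lt hy hbdd).mono fun n hn => ?_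
  calc dist (folnerAverage θ F n f x) (folnerAverage θ F n f y)
      = |∫ z, f z ∂orbitMeasure θ F n x - ∫ z, f z ∂orbitMeasure θ F n y| := by
        rw [integral_orbitMeasure, integral_orbitMeasure, Real.dist_eq]
    _ ≤ ε / 2 + C * wasserstein (orbitMeasure θ F n x) (orbitMeasure θ F n y) :=
        abs_integral_sub_integral_le hC.le hf
    _ < ε / 2 + ε / 2 := by
        rw [lt_div_iff₀' hC] at hn
        gcongr
    _ = ε := add_halves ε

theorem exists_subseq_averagesTendsto (hF : IsAveraging θ F)
    (h : IsWeaklyMeanEquicontinuous X θ F) :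
    ∃ (φ : ℕ → ℕ) (S : C(X, ℝ) →L[ℝ] C(X, ℝ)),
      StrictMono φ ∧ AveragesTendsto θ (F ∘ φ) S := by
  have hequi : AsymptoticallyEquicontinuous
      fun n (p : C(X, ℝ) × X) => folnerAverage θ F n p.1 p.2 := by
    rintro ⟨f, x⟩ ε hε
    rw [nhds_prod_eq]
    have hball : ∀ᶠ f' in 𝓝 f, f' ∈ Metric.ball f (ε / 2) := Metric.ball_mem_nhds f (half_pos hε)
    refine (hball.prod_mk
      (h.asymptoticallyEquicontinuous hF f x (ε / 2) (half_pos hε))).mono ?_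
    rintro ⟨f', y⟩ ⟨hf', hy⟩
    refine hy.mono fun n hn => ?_
    calc dist (folnerAverage θ F n f x) (folnerAverage θ F n f' y)
        ≤ dist (folnerAverage θ F n f x) (folnerAverage θ F n f y)
          + dist (folnerAverage θ F n f y) (folnerAverage θ F n f' y) := dist_triangle ..
      _ < ε / 2 + ε / 2 :=
        add_lt_add_of_lt_of_le hn
          ((dist_folnerAverage_le hF n f f' y).trans (Metric.mem_ball'.1 hf').le)
      _ = ε := add_halves ε
  have hbdd (p : C(X, ℝ) × X) :
      Bornology.IsBounded (Set.range fun n => folnerAverage θ F n p.1 p.2) :=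
    isBounded_iff_forall_norm_le.2
      ⟨‖p.1‖, Set.forall_mem_range.2 fun n => norm_folnerAverage_le hF n p.1 p.2⟩
  obtain ⟨φ, L, hφ, hLcont, hL⟩ := hequi.exists_subseq_tendsto hbdd
  obtain ⟨S, hS⟩ := exists_continuousLinearMap_of_tendsto (hF.comp φ)
    (L := fun f x => L (f, x)) (fun f => by fun_prop) fun f x => hL (f, x)
  exact ⟨φ, S, hφ, hS⟩

end Averages

/-! ### The limit operator -/

/-- The operator `S` is given by integration against the family of measures `μ`, that is,
`S f (x) = ∫ f dμ_x`. -/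
def IsRepresentedBy {X : Type*} [TopologicalSpace X] [MeasurableSpace X] [OpensMeasurableSpace X]
    (S : C(X, ℝ) →L[ℝ] C(X, ℝ)) (μ : X → ProbabilityMeasure X) : Prop :=
  ∀ (f : C(X, ℝ)) (x : X), S f x = ∫ y, f y ∂(μ x : Measure X)

lemma exists_isRepresentedBy {X : Type*} [TopologicalSpace X] [CompactSpace X] [T2Space X]
    [MeasurableSpace X] [BorelSpace X] {S : C(X, ℝ) →L[ℝ] C(X, ℝ)} (hpos : ∀ f, 0 ≤ f → 0 ≤ S f)
    (hone : S 1 = 1) : ∃ μ : X → ProbabilityMeasure X, Continuous μ ∧ IsRepresentedBy S μ := by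
  choose μ hμ using fun x => exists_probabilityMeasure_of_nonneg
    ((ContinuousMap.evalCLM ℝ x).toLinearMap.comp S.toLinearMap)
    (fun f hf => hpos f hf x) (by simp [hone])
  have hμS : IsRepresentedBy S μ := fun f x => (hμ x f).symm
  refine ⟨μ, continuous_iff_continuousAt.2 fun x => tendsto_probabilityMeasure_iff.2 fun f => ?_,
    hμS⟩
  simp only [← hμS f]
  exact (S f).continuous.continuousAt

lemma AveragesTendsto.nonneg {G X : Type*} [Group G] [MeasurableSpace G] [MetricSpace X]
    [CompactSpace X] [MulAction G X] {θ : Measure G} {F : ℕ → Set G}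
    {S : C(X, ℝ) →L[ℝ] C(X, ℝ)} (hS : AveragesTendsto θ F S) {f : C(X, ℝ)} (hf : 0 ≤ f) :
    0 ≤ S f := fun x =>
  ge_of_tendsto' (hS f x) fun _ => mul_nonneg (inv_nonneg.2 measureReal_nonneg)
    (integral_nonneg fun g => hf (g • x))

section Limit

variable {G X : Type*} [Group G] [TopologicalSpace G] [MeasurableSpace G] [BorelSpace G]
  [MetricSpace X] [CompactSpace X] [MeasurableSpace X] [BorelSpace X] [MulAction G X]
  [ContinuousSMul G X] {θ : Measure G} {F : ℕ → Set G} {S : C(X, ℝ) →L[ℝ] C(X, ℝ)}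
  {μ : X → ProbabilityMeasure X}

lemma AveragesTendsto.map_one (hF : IsAveraging θ F) (hS : AveragesTendsto θ F S) : S 1 = 1 :=
  ContinuousMap.ext fun x => tendsto_nhds_unique (hS 1 x)
    (tendsto_const_nhds.congr fun n => (folnerAverage_one hF n x).symm)

lemma AveragesTendsto.norm_le_one (hF : IsAveraging θ F) (hS : AveragesTendsto θ F S) :
    ‖S‖ ≤ 1 :=
  S.opNorm_le_bound zero_le_one fun f => by
    rw [one_mul, ContinuousMap.norm_le _ (norm_nonneg f)]
    exact fun x => le_of_tendsto' (hS f x).norm fun n => norm_folnerAverage_le hF n f x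

lemma AveragesTendsto.exists_isRepresentedBy (hF : IsAveraging θ F) (hS : AveragesTendsto θ F S) :
    ∃ μ : X → ProbabilityMeasure X, Continuous μ ∧ IsRepresentedBy S μ :=
  FolnerAverages.exists_isRepresentedBy (fun _ => hS.nonneg) (hS.map_one hF)

theorem AveragesTendsto.isWeaklyMeanEquicontinuous (hF : IsAveraging θ F)
    (hS : AveragesTendsto θ F S) (hμc : Continuous μ) (hμ : IsRepresentedBy S μ) :
    IsWeaklyMeanEquicontinuous X θ F := by
  let ν (n : ℕ) (x : X) : ProbabilityMeasure X :=
    ⟨orbitMeasure θ F n x, hF.isProbabilityMeasure_orbitMeasure n x⟩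
  have hlim (x : X) : Tendsto (fun n => ν n x) atTop (𝓝 (μ x)) :=
    tendsto_probabilityMeasure_iff.2 fun f => by
      simpa only [ν, ProbabilityMeasure.coe_mk, integral_orbitMeasure, ← hμ f x] using hS f x
  have hpseudo (p : X × X) : folnerPseudometric θ F p.1 p.2 =
      wasserstein (μ p.1 : Measure X) (μ p.2 : Measure X) :=
    ((continuous_wasserstein.tendsto _).comp
      ((hlim p.1).prodMk_nhds (hlim p.2))).limsup_eq
  unfold IsWeaklyMeanEquicontinuous
  simp only [hpseudo]
  exact continuous_wasserstein.comp (hμc.prodMap hμc)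

end Limit

section InvariantMeasure

variable {G X : Type*} [Group G] [TopologicalSpace G] [MeasurableSpace G] [BorelSpace G]
  [MetricSpace X] [CompactSpace X] [MeasurableSpace X] [BorelSpace X] [MulAction G X]
  [ContinuousSMul G X] {θ : Measure G} {F : ℕ → Set G} {S : C(X, ℝ) →L[ℝ] C(X, ℝ)}

lemma continuous_folnerAverage (hF : IsAveraging θ F) (n : ℕ) (f : C(X, ℝ)) :
    Continuous (folnerAverage θ F n f) := by
  have := hF.isFiniteMeasure_restrict n
  refine continuous_const.mul (continuous_of_dominated (bound := fun _ => ‖f‖) (fun x => ?_)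
    (fun x => .of_forall fun g => f.norm_coe_le_norm _) (integrable_const _)
    (.of_forall fun g => by fun_prop))
  exact (f.continuous.measurable.comp (measurable_smul_left x)).aestronglyMeasurable

lemma integral_folnerAverage (hF : IsAveraging θ F) (ν : Measure X) [IsFiniteMeasure ν]
    [SMulInvariantMeasure G X ν] (n : ℕ) (f : C(X, ℝ)) :
    ∫ y, folnerAverage θ F n f y ∂ν = ∫ y, f y ∂ν := by
  have := hF.isFiniteMeasure_restrict n
  have hcont : Continuous fun p : X × G => f (p.2 • p.1) := by fun_prop
  have hint : Integrable (fun p : X × G => f (p.2 • p.1)) (ν.prod (θ.restrict (F n))) :=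
    .of_bound hcont.measurable.aestronglyMeasurable ‖f‖ (.of_forall fun p => f.norm_coe_le_norm _)
  have hinv (g : G) : ∫ y, f (g • y) ∂ν = ∫ y, f y ∂ν :=
    (smulInvariantMeasure_iff_integral_koopman ν).1 inferInstance g f
  calc ∫ y, folnerAverage θ F n f y ∂ν
      = (θ.real (F n))⁻¹ * ∫ g in F n, ∫ y, f (g • y) ∂ν ∂θ := by
        simp only [folnerAverage]
        rw [integral_const_mul, integral_integral_swap hint]
    _ = ∫ y, f y ∂ν := by
        simp only [hinv, integral_const, smul_eq_mul, measureReal_restrict_apply_univ]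
        exact inv_mul_cancel_left₀ (hF.real_pos n).ne' _

lemma AveragesTendsto.integral_eq (hF : IsAveraging θ F) (hS : AveragesTendsto θ F S)
    (ν : Measure X) [IsFiniteMeasure ν] [SMulInvariantMeasure G X ν] (f : C(X, ℝ)) :
    ∫ y, S f y ∂ν = ∫ y, f y ∂ν := by
  have hlim : Tendsto (fun n => ∫ y, folnerAverage θ F n f y ∂ν) atTop (𝓝 (∫ y, S f y ∂ν)) :=
    tendsto_integral_of_dominated_convergence (fun _ => ‖f‖)
      (fun n => (continuous_folnerAverage hF n f).measurable.aestronglyMeasurable)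
      (integrable_const _) (fun n => .of_forall fun y => norm_folnerAverage_le hF n f y)
      (.of_forall fun y => hS f y)
  exact tendsto_nhds_unique hlim
    (tendsto_const_nhds.congr fun n => (integral_folnerAverage hF ν n f).symm)

end InvariantMeasure

/-! ### Asymptotic invariance of Følner averages -/

section SetAverage

variable {α : Type*} [MeasurableSpace α] {m : Measure α}

lemma abs_setIntegral_sub_setIntegral_le {A B : Set α} (hA : MeasurableSet A)
    (hB : MeasurableSet B) (hA' : m A ≠ ⊤) (hB' : m B ≠ ⊤) {a : α → ℝ} (ha : Measurable a) {C : ℝ}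
    (hC : ∀ y, |a y| ≤ C) :
    |∫ y in A, a y ∂m - ∫ y in B, a y ∂m| ≤ C * m.real (A ∆ B) := by
  have hint {D : Set α} (hD : m D ≠ ⊤) : IntegrableOn a D m :=
    Measure.integrableOn_of_bounded hD ha.aestronglyMeasurable (.of_forall hC)
  have hAB : m (A \ B) ≠ ⊤ := measure_ne_top_of_subset Set.sdiff_subset hA'
  have hBA : m (B \ A) ≠ ⊤ := measure_ne_top_of_subset Set.sdiff_subset hB'
  have hsplitB := integral_inter_add_sdiff hA (hint hB')
  rw [Set.inter_comm] at hsplitB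
  calc |∫ y in A, a y ∂m - ∫ y in B, a y ∂m|
      = |∫ y in A \ B, a y ∂m - ∫ y in B \ A, a y ∂m| := by
        rw [← integral_inter_add_sdiff hB (hint hA'), ← hsplitB, add_sub_add_left_eq_sub]
    _ ≤ |∫ y in A \ B, a y ∂m| + |∫ y in B \ A, a y ∂m| := abs_sub _ _
    _ ≤ C * m.real (A \ B) + C * m.real (B \ A) :=
        add_le_add (norm_setIntegral_le_of_norm_le_const (f := a) hAB.lt_top fun y _ => hC y)
          (norm_setIntegral_le_of_norm_le_const (f := a) hBA.lt_top fun y _ => hC y)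
    _ = C * m.real (A ∆ B) := by
        rw [← mul_add, Set.symmDiff_def,
          measureReal_union disjoint_sdiff_sdiff (hB.diff hA) hAB hBA]

lemma IsAveraging.tendsto_setAverage_sub_of_symmDiff {F E : ℕ → Set α} (hF : IsAveraging m F)
    (hE : ∀ n, MeasurableSet (E n)) (hEF : ∀ n, m (E n) = m (F n))
    (h : Tendsto (fun n => m (F n ∆ E n) / m (F n)) atTop (𝓝 0)) {a : α → ℝ} (ha : Measurable a)
    {C : ℝ} (hC : ∀ y, |a y| ≤ C) :
    Tendsto (fun n => ⨍ y in E n, a y ∂m - ⨍ y in F n, a y ∂m) atTop (𝓝 0) := by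
  have hlim : Tendsto (fun n => C * (m.real (F n ∆ E n) / m.real (F n))) atTop (𝓝 0) := by
    have := (ENNReal.tendsto_toReal ENNReal.zero_ne_top).comp h
    simpa [Function.comp_def, ENNReal.toReal_div, Measure.real] using this.const_mul C
  refine squeeze_zero_norm (fun n => ?_) hlim
  have hEF' : m.real (E n) = m.real (F n) := congrArg ENNReal.toReal (hEF n)
  calc ‖⨍ y in E n, a y ∂m - ⨍ y in F n, a y ∂m‖
      = (m.real (F n))⁻¹ * |∫ y in F n, a y ∂m - ∫ y in E n, a y ∂m| := by
        rw [setAverage_eq, setAverage_eq, hEF', ← smul_sub, norm_smul, norm_inv,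
          Real.norm_of_nonneg (hF.real_pos n).le, Real.norm_eq_abs, abs_sub_comm]
    _ ≤ (m.real (F n))⁻¹ * (C * m.real (F n ∆ E n)) := by
        gcongr
        exact abs_setIntegral_sub_setIntegral_le (hF.measurableSet n) (hE n) (hF.ne_top n)
          (hEF n ▸ hF.ne_top n) ha hC
    _ = C * (m.real (F n ∆ E n) / m.real (F n)) := by ring

lemma setAverage_image_of_measurePreserving {φ : α → α} (hφ : MeasurePreserving φ m m)
    (hφ' : MeasurableEmbedding φ) (a : α → ℝ) (s : Set α) :
    ⨍ y in φ '' s, a y ∂m = ⨍ y in s, a (φ y) ∂m := by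
  have hmeas : m (φ '' s) = m s := by
    rw [← hφ.measure_preimage_emb hφ' (φ '' s), Set.preimage_image_eq _ hφ'.injective]
  rw [setAverage_eq, setAverage_eq, hφ.setIntegral_image_emb hφ', measureReal_def, hmeas,
    ← measureReal_def]

end SetAverage

section Translation

variable {G : Type*} [Group G] [MeasurableSpace G] [MeasurableMul G] (θ : Measure G)

lemma setAverage_singleton_mul [θ.IsMulLeftInvariant] (g : G) (s : Set G) (a : G → ℝ) :
    ⨍ h in {g} * s, a h ∂θ = ⨍ h in s, a (g * h) ∂θ := by
  rw [Set.singleton_mul, setAverage_image_of_measurePreserving (measurePreserving_mul_left θ g)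
    (measurableEmbedding_mulLeft g)]

lemma measure_singleton_mul [θ.IsMulLeftInvariant] (g : G) (s : Set G) : θ ({g} * s) = θ s := by
  rw [Set.singleton_mul, Set.image_mul_left, measure_preimage_mul]

lemma setAverage_mul_singleton [θ.IsMulRightInvariant] (g : G) (s : Set G) (a : G → ℝ) :
    ⨍ h in s * {g}, a h ∂θ = ⨍ h in s, a (h * g) ∂θ := by
  rw [Set.mul_singleton, setAverage_image_of_measurePreserving (measurePreserving_mul_right θ g)
    (measurableEmbedding_mulRight g)]

lemma measure_mul_singleton [θ.IsMulRightInvariant] (g : G) (s : Set G) : θ (s * {g}) = θ s := by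
  rw [Set.mul_singleton, Set.image_mul_right, measure_preimage_mul_right]

end Translation

section TranslatedAverages

variable {G X : Type*} [Group G] [MeasurableSpace G] [MetricSpace X] [MulAction G X]
  {θ : Measure G} {F : ℕ → Set G}

lemma folnerAverage_eq_setAverage (n : ℕ) (f : C(X, ℝ)) (x : X) :
    folnerAverage θ F n f x = ⨍ h in F n, f (h • x) ∂θ := by
  rw [setAverage_eq]
  rfl

lemma folnerAverage_koopman [TopologicalSpace G] [MeasurableMul G] [ContinuousSMul G X]
    [θ.IsMulLeftInvariant] (n : ℕ) (g : G) (f : C(X, ℝ)) (x : X) :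
    folnerAverage θ F n (koopman g f) x = ⨍ h in {g} * F n, f (h • x) ∂θ := by
  simp only [folnerAverage_eq_setAverage, setAverage_singleton_mul, koopman_apply, mul_smul]

lemma folnerAverage_smul_point [MeasurableMul G] [θ.IsMulRightInvariant] (n : ℕ) (g : G)
    (f : C(X, ℝ)) (x : X) :
    folnerAverage θ F n f (g • x) = ⨍ h in F n * {g}, f (h • x) ∂θ := by
  simp only [folnerAverage_eq_setAverage, setAverage_mul_singleton, mul_smul]

end TranslatedAverages

section OrbitFunction

variable {G X : Type*} [Group G] [TopologicalSpace G] [TopologicalSpace X] [CompactSpace X]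
  [MulAction G X] [ContinuousSMul G X]

/-- The bounded continuous function `h ↦ f (h x)` on the group. -/
noncomputable def orbitFunction (f : C(X, ℝ)) (x : X) : G →ᵇ ℝ :=
  .ofNormedAddCommGroup (fun h => f (h • x)) (by fun_prop) ‖f‖ fun h => f.norm_coe_le_norm _

@[simp]
lemma orbitFunction_apply (f : C(X, ℝ)) (x : X) (h : G) : orbitFunction f x h = f (h • x) := rfl

lemma isRightUniformlyContinuous_orbitFunction (f : C(X, ℝ)) (x : X) :
    IsRightUniformlyContinuous (G := G) (orbitFunction f x) := by
  intro ε hε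
  have hcont : Continuous fun z : G × X => |f (z.1 • z.2) - f z.2| := by fun_prop
  have hnear : ∀ᶠ v in 𝓝 (1 : G), ∀ y ∈ (Set.univ : Set X), |f (v • y) - f y| < ε :=
    isCompact_univ.eventually_forall_of_forall_eventually fun y _ =>
      hcont.continuousAt.eventually_lt_const (by simpa using hε)
  exact ⟨_, hnear, fun v hv h => by simpa [mul_smul] using hv (h • x) (Set.mem_univ _)⟩

end OrbitFunction

lemma isAveraging_of_isCompact {α : Type*} [TopologicalSpace α] [T2Space α]
    [MeasurableSpace α] [OpensMeasurableSpace α] {θ : Measure α} [IsFiniteMeasureOnCompacts θ]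
    {F : ℕ → Set α} (hF : ∀ n, IsCompact (F n)) (hpos : ∀ n, 0 < θ (F n)) :
    IsAveraging θ F :=
  ⟨fun n => (hF n).measurableSet, fun n => (hpos n).ne', fun n => (hF n).measure_lt_top.ne⟩

section Thick

variable {G X : Type*} [Group G] [TopologicalSpace G] [T2Space G] [MeasurableSpace G]
  [BorelSpace G] {θ : Measure G} {F : ℕ → Set G}

lemma IsThickLeftFolner.isAveraging (hF : IsThickLeftFolner θ F) : IsAveraging θ F :=
  have := hF.haar.1
  isAveraging_of_isCompact hF.isCompact hF.pos

lemma IsThickRightFolner.isAveraging (hF : IsThickRightFolner θ F) : IsAveraging θ F :=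
  have := hF.haar.1
  isAveraging_of_isCompact hF.isCompact hF.pos

variable [IsTopologicalGroup G] [MetricSpace X] [CompactSpace X] [MulAction G X]
  [ContinuousSMul G X]

theorem IsThickLeftFolner.tendsto_koopman_sub (hF : IsThickLeftFolner θ F) (g : G) (f : C(X, ℝ))
    (x : X) :
    Tendsto (fun n => folnerAverage θ F n (koopman g f) x - folnerAverage θ F n f x)
      atTop (𝓝 0) := by
  have := hF.haar.2.2
  have hE (n : ℕ) : MeasurableSet ({g} * F n) :=
    (isCompact_singleton.mul (hF.isCompact n)).measurableSet
  simp_rw [folnerAverage_koopman, folnerAverage_eq_setAverage]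
  exact hF.isAveraging.tendsto_setAverage_sub_of_symmDiff hE (fun n => measure_singleton_mul θ g _)
    (hF.tendsto {g} isCompact_singleton (Set.singleton_nonempty g))
    (orbitFunction f x).continuous.measurable fun h => f.norm_coe_le_norm _

theorem IsThickRightFolner.tendsto_smul_sub (hF : IsThickRightFolner θ F) (g : G) (f : C(X, ℝ))
    (x : X) :
    Tendsto (fun n => folnerAverage θ F n f (g • x) - folnerAverage θ F n f x)
      atTop (𝓝 0) := by
  have := hF.haar.2.2
  have hE (n : ℕ) : MeasurableSet (F n * {g}) :=
    ((hF.isCompact n).mul isCompact_singleton).measurableSet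
  simp_rw [folnerAverage_smul_point, folnerAverage_eq_setAverage]
  exact hF.isAveraging.tendsto_setAverage_sub_of_symmDiff hE (fun n => measure_mul_singleton θ g _)
    (hF.tendsto {g} isCompact_singleton (Set.singleton_nonempty g))
    (orbitFunction f x).continuous.measurable fun h => f.norm_coe_le_norm _

end Thick

/-! ### Matchings -/

section Matching

variable {α : Type*}

/-- The maximal cardinality of a subset `M ⊆ F` with an injection `φ : M → E` such that
`r f (φ f)` for all `f ∈ M`. Both kinds of `V`-matching numbers are of this form. -/
noncomputable def relMatchingNumber (r : α → α → Prop) (F E : Set α) : ℕ :=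
  sSup {k | ∃ M ⊆ F, M.ncard = k ∧ ∃ φ : α → α,
    Set.InjOn φ M ∧ Set.MapsTo φ M E ∧ ∀ f ∈ M, r f (φ f)}

lemma exists_matching (r : α → α → Prop) {F : Set α} (hF : F.Finite) (E : Set α) :
    ∃ M ⊆ F, M.ncard = relMatchingNumber r F E ∧ ∃ φ : α → α,
      Set.InjOn φ M ∧ Set.MapsTo φ M E ∧ ∀ f ∈ M, r f (φ f) :=
  Nat.sSup_mem (s := {k | ∃ M ⊆ F, M.ncard = k ∧ ∃ φ : α → α,
      Set.InjOn φ M ∧ Set.MapsTo φ M E ∧ ∀ f ∈ M, r f (φ f)})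
    ⟨0, ∅, Set.empty_subset _, Set.ncard_empty _, id, by simp, by simp [Set.MapsTo], by simp⟩
    ⟨F.ncard, by rintro _ ⟨M, hM, rfl, -⟩; exact Set.ncard_le_ncard hM hF⟩

lemma abs_sum_sub_sum_le_of_subset {F M : Finset α} (hM : M ⊆ F) {a : α → ℝ} {C : ℝ}
    (hC : ∀ y, |a y| ≤ C) :
    |∑ y ∈ F, a y - ∑ y ∈ M, a y| ≤ C * (F.card - M.card) := by
  classical
  rw [← Finset.sum_sdiff_eq_sub hM, ← Finset.cast_card_sdiff hM, mul_comm, ← nsmul_eq_mul]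
  exact (Finset.abs_sum_le_sum_abs _ _).trans (Finset.sum_le_card_nsmul _ _ C fun y _ => hC y)

lemma abs_sum_sub_sum_le_of_matching {F E M : Finset α} (hM : M ⊆ F) (hcard : E.card = F.card)
    {φ : α → α} (hinj : Set.InjOn φ M) (hmaps : ∀ f ∈ M, φ f ∈ E) {a : α → ℝ} {C ε : ℝ}
    (hC : ∀ y, |a y| ≤ C) (hε : 0 ≤ ε) (ha : ∀ f ∈ M, |a (φ f) - a f| ≤ ε) :
    |∑ y ∈ E, a y - ∑ y ∈ F, a y| ≤ ε * F.card + 2 * C * (F.card - M.card) := by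
  classical
  have hE : |∑ y ∈ E, a y - ∑ f ∈ M, a (φ f)| ≤ C * (F.card - M.card) := by
    simpa only [Finset.sum_image hinj, Finset.card_image_of_injOn hinj, hcard] using
      abs_sum_sub_sum_le_of_subset (Finset.image_subset_iff.2 hmaps) hC
  have hφ : |∑ f ∈ M, a (φ f) - ∑ f ∈ M, a f| ≤ ε * F.card := by
    calc |∑ f ∈ M, a (φ f) - ∑ f ∈ M, a f|
        ≤ ∑ f ∈ M, |a (φ f) - a f| := by
          rw [← Finset.sum_sub_distrib]
          exact Finset.abs_sum_le_sum_abs _ _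
      _ ≤ M.card • ε := Finset.sum_le_card_nsmul _ _ ε ha
      _ = ε * M.card := by rw [nsmul_eq_mul, mul_comm]
      _ ≤ ε * F.card := by
          gcongr
  have hF : |∑ f ∈ M, a f - ∑ y ∈ F, a y| ≤ C * (F.card - M.card) := by
    rw [abs_sub_comm]
    exact abs_sum_sub_sum_le_of_subset hM hC
  rw [abs_le] at hE hφ hF ⊢
  constructor <;> linarith [hE.1, hE.2, hφ.1, hφ.2, hF.1, hF.2]

variable [MeasurableSpace α] [MeasurableSingletonClass α]

lemma isAveraging_count {F : ℕ → Set α} (hF : ∀ n, (F n).Finite) (hne : ∀ n, (F n).Nonempty) :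
    IsAveraging Measure.count F :=
  ⟨fun n => (hF n).measurableSet, fun n => Measure.count_ne_zero (hne n),
    fun n => (Measure.count_apply_lt_top.2 (hF n)).ne⟩

lemma setAverage_count {E : Type*} [NormedAddCommGroup E] [NormedSpace ℝ E] [CompleteSpace E]
    (s : Finset α) (a : α → E) :
    ⨍ y in s, a y ∂Measure.count = (s.card : ℝ)⁻¹ • ∑ y ∈ s, a y := by
  have hint : IntegrableOn a s Measure.count := by
    rw [← Set.biUnion_of_singleton (s : Set α)]
    simp [integrableOn_finset_iUnion]
  rw [setAverage_eq, setIntegral_finset s hint]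
  simp [Measure.real]

lemma abs_setAverage_count_sub_le (r : α → α → Prop) {F E : Set α} (hF : F.Finite)
    (hE : E.Finite) (hne : F.Nonempty) (hcard : E.ncard = F.ncard) {a : α → ℝ} {C ε : ℝ}
    (hC : ∀ y, |a y| ≤ C) (hε : 0 ≤ ε) (ha : ∀ f h, r f h → |a h - a f| ≤ ε) :
    |⨍ y in E, a y ∂Measure.count - ⨍ y in F, a y ∂Measure.count| ≤
      ε + 2 * C * (1 - relMatchingNumber r F E / F.ncard) := by
  obtain ⟨M, hM, hMcard, φ, hinj, hmaps, hr⟩ := exists_matching r hF E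
  rw [← hMcard]
  lift M to Finset α using hF.subset hM
  lift F to Finset α using hF
  lift E to Finset α using hE
  simp only [Set.ncard_coe_finset] at hcard ⊢
  have hpos : (0 : ℝ) < F.card := by exact_mod_cast Finset.card_pos.2 hne
  have hsum := abs_sum_sub_sum_le_of_matching (Finset.coe_subset.1 hM) hcard hinj hmaps hC hε
    fun f hf => ha f _ (hr f hf)
  rw [setAverage_count, setAverage_count, hcard, ← smul_sub, smul_eq_mul, abs_mul, abs_inv,
    abs_of_pos hpos, inv_mul_le_iff₀ hpos]
  refine hsum.trans_eq ?_
  field_simp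

lemma tendsto_setAverage_count_sub {F E : ℕ → Set α} (hF : ∀ n, (F n).Finite)
    (hE : ∀ n, (E n).Finite) (hne : ∀ n, (F n).Nonempty) (hcard : ∀ n, (E n).ncard = (F n).ncard)
    {a : α → ℝ} {C : ℝ} (hC : ∀ y, |a y| ≤ C)
    (h : ∀ ε > 0, ∃ r : α → α → Prop, (∀ f h, r f h → |a h - a f| ≤ ε) ∧
      Tendsto (fun n => (relMatchingNumber r (F n) (E n) : ℝ) / (F n).ncard) atTop (𝓝 1)) :
    Tendsto (fun n => ⨍ y in E n, a y ∂Measure.count - ⨍ y in F n, a y ∂Measure.count)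
      atTop (𝓝 0) := by
  refine Metric.tendsto_nhds.2 fun ε hε => ?_
  obtain ⟨r, hr, hlim⟩ := h (ε / 2) (half_pos hε)
  have hbound : Tendsto (fun n => ε / 2 + 2 * C *
      (1 - (relMatchingNumber r (F n) (E n) : ℝ) / (F n).ncard)) atTop (𝓝 (ε / 2)) := by
    simpa using ((hlim.const_sub 1).const_mul (2 * C)).const_add (ε / 2)
  filter_upwards [hbound.eventually_lt_const (half_lt_self hε)] with n hn
  rw [Real.dist_eq, sub_zero]
  exact (abs_setAverage_count_sub_le r (hF n) (hE n) (hne n) (hcard n) hC (half_pos hε).le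
    hr).trans_lt hn

end Matching

section MatchingNumber

variable {G : Type*} [Group G]

lemma ncard_singleton_mul (s : Set G) (g : G) :
    ({g} * s).ncard = s.ncard := by
  rw [Set.singleton_mul, Set.ncard_image_of_injective _ (mul_right_injective g)]

lemma ncard_mul_singleton (s : Set G) (g : G) :
    (s * {g}).ncard = s.ncard := by
  rw [Set.mul_singleton, Set.ncard_image_of_injective _ (mul_left_injective g)]

lemma matchingNumber_eq_relMatchingNumber (V F E : Set G) :
    matchingNumber V F E = relMatchingNumber (fun f h => h ∈ V * ({f} : Set G)) F E :=
  rfl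

lemma mirroredMatchingNumber_eq_relMatchingNumber (V F E : Set G) :
    mirroredMatchingNumber V F E = relMatchingNumber (fun f h => h ∈ ({f} : Set G) * V) F E :=
  rfl

variable [TopologicalSpace G] [MeasurableSpace G] [MeasurableSingletonClass G] {F E : ℕ → Set G}

lemma tendsto_setAverage_sub_of_matchingNumber (hF : ∀ n, (F n).Finite)
    (hE : ∀ n, (E n).Finite) (hne : ∀ n, (F n).Nonempty) (hcard : ∀ n, (E n).ncard = (F n).ncard)
    (h : ∀ V : Set G, IsOpen V → (1 : G) ∈ V →
      Tendsto (fun n => (matchingNumber V (F n) (E n) : ℝ) / ((F n).ncard : ℝ)) atTop (𝓝 1))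
    {a : G →ᵇ ℝ} (ha : IsRightUniformlyContinuous a) :
    Tendsto (fun n => ⨍ y in E n, a y ∂Measure.count - ⨍ y in F n, a y ∂Measure.count)
      atTop (𝓝 0) := by
  refine tendsto_setAverage_count_sub hF hE hne hcard (C := ‖a‖) (fun y => a.norm_coe_le_norm y)
    fun ε hε => ?_
  obtain ⟨U, hU, hUa⟩ := ha ε hε
  obtain ⟨V, hVU, hV, h1V⟩ := mem_nhds_iff.1 hU
  simp only [matchingNumber_eq_relMatchingNumber] at h
  refine ⟨fun u w => w ∈ V * ({u} : Set G), fun u w hw => ?_, h V hV h1V⟩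
  obtain ⟨v, hv, _, rfl, rfl⟩ := Set.mem_mul.1 hw
  exact (hUa v (hVU hv) _).le

lemma tendsto_setAverage_sub_of_mirroredMatchingNumber (hF : ∀ n, (F n).Finite)
    (hE : ∀ n, (E n).Finite) (hne : ∀ n, (F n).Nonempty) (hcard : ∀ n, (E n).ncard = (F n).ncard)
    (h : ∀ V : Set G, IsOpen V → (1 : G) ∈ V →
      Tendsto (fun n => (mirroredMatchingNumber V (F n) (E n) : ℝ) / ((F n).ncard : ℝ)) atTop
        (𝓝 1))
    {a : G → ℝ} {C : ℝ} (hC : ∀ y, |a y| ≤ C)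
    (ha : ∀ ε > 0, ∀ᶠ v in 𝓝 (1 : G), ∀ h, |a (h * v) - a h| ≤ ε) :
    Tendsto (fun n => ⨍ y in E n, a y ∂Measure.count - ⨍ y in F n, a y ∂Measure.count)
      atTop (𝓝 0) := by
  refine tendsto_setAverage_count_sub hF hE hne hcard hC fun ε hε => ?_
  obtain ⟨V, hVa, hV, h1V⟩ := eventually_nhds_iff.1 (ha ε hε)
  simp only [mirroredMatchingNumber_eq_relMatchingNumber] at h
  refine ⟨fun u w => w ∈ ({u} : Set G) * V, fun u w hw => ?_, h V hV h1V⟩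
  obtain ⟨_, rfl, v, hv, rfl⟩ := Set.mem_mul.1 hw
  exact hVa v hv _

end MatchingNumber

section Thin

variable {G X : Type*} [Group G] [TopologicalSpace G] [IsTopologicalGroup G] [T2Space G]
  [MeasurableSpace G] [BorelSpace G] [MetricSpace X] [CompactSpace X] [MulAction G X]
  [ContinuousSMul G X] {θ : Measure G} {F : ℕ → Set G}

theorem IsThinLeftFolner.tendsto_koopman_sub (hF : IsThinLeftFolner θ F) (g : G) (f : C(X, ℝ))
    (x : X) :
    Tendsto (fun n => folnerAverage θ F n (koopman g f) x - folnerAverage θ F n f x)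
      atTop (𝓝 0) := by
  obtain ⟨rfl, hfin, hne, hlim⟩ := hF
  simp_rw [folnerAverage_koopman, folnerAverage_eq_setAverage]
  exact tendsto_setAverage_sub_of_matchingNumber hfin
    (fun n => (Set.finite_singleton g).mul (hfin n)) hne (fun n => ncard_singleton_mul _ g)
    (hlim g) (isRightUniformlyContinuous_orbitFunction f x)

theorem IsThinRightFolner.tendsto_smul_sub (hF : IsThinRightFolner θ F) (g : G) (f : C(X, ℝ))
    (x : X) :
    Tendsto (fun n => folnerAverage θ F n f (g • x) - folnerAverage θ F n f x)
      atTop (𝓝 0) := by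
  obtain ⟨rfl, hfin, hne, hlim⟩ := hF
  simp_rw [folnerAverage_smul_point, folnerAverage_eq_setAverage]
  exact tendsto_setAverage_sub_of_matchingNumber hfin
    (fun n => (hfin n).mul (Set.finite_singleton g)) hne (fun n => ncard_mul_singleton _ g)
    (hlim g) (isRightUniformlyContinuous_orbitFunction f x)

end Thin

/-! ### Mirrored thin right Følner sequences -/

section LocallyCompact

lemma nonpos_of_forall_setIntegral_isCompact_eq_zero {α : Type*} [TopologicalSpace α]
    [LocallyCompactSpace α] [T2Space α] [MeasurableSpace α] [BorelSpace α] {m : Measure α}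
    [m.IsOpenPosMeasure] [IsFiniteMeasureOnCompacts m] {φ : α → ℝ} (hφ : Continuous φ)
    (h : ∀ K : Set α, IsCompact K → ∫ v in K, φ v ∂m = 0) (u : α) : φ u ≤ 0 := by
  by_contra! hu
  obtain ⟨K, huK, hKφ, hK⟩ :=
    local_compact_nhds ((isOpen_lt continuous_const hφ).mem_nhds hu)
  have hpos : 0 ≤ᵐ[m.restrict K] φ :=
    (ae_restrict_mem hK.measurableSet).mono fun v hv => (hKφ hv).le
  refine ((setIntegral_pos_iff_support_of_nonneg_ae hpos
    (hφ.continuousOn.integrableOn_compact hK)).2 ?_).ne' (h K hK)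
  exact (Measure.measure_pos_of_mem_nhds m huK).trans_le
    (measure_mono fun v hv => ⟨(hKφ hv).ne', hv⟩)

lemma eq_zero_of_forall_setIntegral_isCompact_eq_zero {α : Type*} [TopologicalSpace α]
    [LocallyCompactSpace α] [T2Space α] [MeasurableSpace α] [BorelSpace α] {m : Measure α}
    [m.IsOpenPosMeasure] [IsFiniteMeasureOnCompacts m] {φ : α → ℝ} (hφ : Continuous φ)
    (h : ∀ K : Set α, IsCompact K → ∫ v in K, φ v ∂m = 0) : φ = 0 := by
  funext u
  refine le_antisymm (nonpos_of_forall_setIntegral_isCompact_eq_zero hφ h u) ?_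
  refine neg_nonpos.1 (nonpos_of_forall_setIntegral_isCompact_eq_zero (m := m) hφ.neg
    (fun K hK => ?_) u)
  exact (integral_neg φ).trans (by rw [h K hK, neg_zero])

variable {G : Type*} [Group G] [TopologicalSpace G] [IsTopologicalGroup G] [T2Space G]
  [LocallyCompactSpace G] [MeasurableSpace G] [BorelSpace G]

lemma eventually_measureReal_smul_symmDiff_le (m : Measure G) [m.IsHaarMeasure] [m.Regular]
    {K : Set G} (hK : IsCompact K) {ε : ℝ} (hε : 0 < ε) :
    ∀ᶠ w in 𝓝 (1 : G), m.real ((w • K) ∆ K) ≤ ε := by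
  have hout : ∀ᶠ w in 𝓝 (1 : G), m (w • K \ K) < ENNReal.ofReal (ε / 2) :=
    eventually_nhds_one_measure_smul_sdiff_lt hK hK.isClosed (by simpa using hε)
  have hin : ∀ᶠ w in 𝓝 (1 : G), m (w⁻¹ • K \ K) < ENNReal.ofReal (ε / 2) :=
    (tendsto_inv (1 : G)).eventually (by rwa [inv_one])
  filter_upwards [hout, hin] with w hw hw'
  have htranslate : m (K \ w • K) = m (w⁻¹ • K \ K) := by
    rw [← measure_smul m w (w⁻¹ • K \ K), Set.smul_set_sdiff, smul_inv_smul]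
  have hleft : m.real (w • K \ K) ≤ ε / 2 :=
    ENNReal.toReal_le_of_le_ofReal (half_pos hε).le hw.le
  have hright : m.real (K \ w • K) ≤ ε / 2 :=
    ENNReal.toReal_le_of_le_ofReal (half_pos hε).le (htranslate ▸ hw'.le)
  exact (measureReal_union_le _ _).trans ((add_le_add hleft hright).trans_eq (add_halves ε))

lemma eventually_abs_setIntegral_mul_sub_le (m : Measure G) [m.IsHaarMeasure] [m.Regular]
    {K : Set G} (hK : IsCompact K) (a : G →ᵇ ℝ) {ε : ℝ} (hε : 0 < ε) :
    ∀ᶠ w in 𝓝 (1 : G), ∀ h : G, |∫ v in K, a (h * w * v) ∂m - ∫ v in K, a (h * v) ∂m| ≤ ε := by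
  filter_upwards [eventually_measureReal_smul_symmDiff_le m hK
    (ε := ε / (‖a‖ + 1)) (by positivity)] with w hw h
  have htranslate : ∫ v in K, a (h * w * v) ∂m = ∫ v in w • K, a (h * v) ∂m := by
    simp only [mul_assoc]
    exact ((measurePreserving_mul_left m w).setIntegral_image_emb
      (Homeomorph.mulLeft w).measurableEmbedding (fun v => a (h * v)) K).symm
  rw [htranslate]
  have hwK : IsCompact (w • K) := hK.smul w
  calc |∫ v in w • K, a (h * v) ∂m - ∫ v in K, a (h * v) ∂m|
      ≤ ‖a‖ * m.real ((w • K) ∆ K) :=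
        abs_setIntegral_sub_setIntegral_le hwK.measurableSet hK.measurableSet
          hwK.measure_lt_top.ne hK.measure_lt_top.ne
          (a.continuous.comp (continuous_const_mul h)).measurable fun v => a.norm_coe_le_norm _
    _ ≤ (‖a‖ + 1) * (ε / (‖a‖ + 1)) := by gcongr; linarith
    _ = ε := by field_simp

end LocallyCompact

section MirroredThin

variable {G X : Type*} [Group G] [TopologicalSpace G] [MeasurableSpace G] [BorelSpace G]
  [MetricSpace X] [CompactSpace X] [MulAction G X] [ContinuousSMul G X]
  {θ : Measure G} {F : ℕ → Set G} {S : C(X, ℝ) →L[ℝ] C(X, ℝ)}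

lemma integral_folnerAverage_count [IsTopologicalGroup G] [T2Space G] {n : ℕ}
    (hF : (F n).Finite) (ρ : Measure G) [IsFiniteMeasure ρ] (g : G) (f : C(X, ℝ)) (x : X) :
    ∫ v, folnerAverage Measure.count F n f (g • v • x) ∂ρ =
      ⨍ h in F n * {g}, ∫ v, f ((h * v) • x) ∂ρ ∂Measure.count := by
  have hint (h : G) : Integrable (fun v => f ((h * g) • v • x)) ρ :=
    .of_bound (Continuous.measurable (by fun_prop)).aestronglyMeasurable ‖f‖
      (.of_forall fun v => f.norm_coe_le_norm _)
  lift F n to Finset G using hF with s hs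
  simp only [folnerAverage_eq_setAverage, setAverage_mul_singleton, ← hs, setAverage_count,
    ← mul_smul]
  simp only [smul_eq_mul, mul_assoc] at hint ⊢
  rw [integral_const_mul, integral_finsetSum s fun h _ => by simpa only [mul_smul] using hint h]

variable [MeasurableSpace X] [BorelSpace X]

lemma AveragesTendsto.tendsto_integral_smul (hav : IsAveraging θ F) (hS : AveragesTendsto θ F S)
    (ρ : Measure G) [IsFiniteMeasure ρ] (g : G) (f : C(X, ℝ)) (x : X) :
    Tendsto (fun n => ∫ v, folnerAverage θ F n f (g • v • x) ∂ρ) atTop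
      (𝓝 (∫ v, S f (g • v • x) ∂ρ)) :=
  tendsto_integral_of_dominated_convergence (fun _ => ‖f‖)
    (fun n => ((continuous_folnerAverage hav n f).comp
      (by fun_prop : Continuous fun v : G => g • v • x)).measurable.aestronglyMeasurable)
    (integrable_const _) (fun n => .of_forall fun v => norm_folnerAverage_le hav n f _)
    (.of_forall fun v => hS f _)

variable [IsTopologicalGroup G] [T2Space G] [LocallyCompactSpace G]

/-- The functions `h ↦ f (h x)` need not be uniformly continuous under perturbations `h v` on the
right, but their averages `h ↦ ∫ v in K, f (h v x)` are, since `w K` is close to `K` in Haar measure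
for small `w`. -/
theorem IsMirroredThinRightFolner.setIntegral_apply_smul_eq
    (hF : IsMirroredThinRightFolner θ F) (hS : AveragesTendsto θ F S) (m : Measure G)
    [m.IsHaarMeasure] [m.Regular] {K : Set G} (hK : IsCompact K) (g : G) (f : C(X, ℝ)) (x : X) :
    ∫ v in K, S f (g • v • x) ∂m = ∫ v in K, S f (v • x) ∂m := by
  obtain ⟨rfl, hfin, hne, hlim⟩ := hF
  have : IsFiniteMeasure (m.restrict K) := isFiniteMeasure_restrict.2 hK.measure_lt_top.ne
  have hasymp := tendsto_setAverage_sub_of_mirroredMatchingNumber hfin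
    (fun n => (hfin n).mul (Set.finite_singleton g)) hne (fun n => ncard_mul_singleton _ g)
    (hlim g) (a := fun h => ∫ v in K, f ((h * v) • x) ∂m)
    (fun h => norm_setIntegral_le_of_norm_le_const hK.measure_lt_top
      fun v _ => f.norm_coe_le_norm _)
    fun ε hε => eventually_abs_setIntegral_mul_sub_le m hK (orbitFunction f x) hε
  have hconv (u : G) : Tendsto (fun n =>
      ⨍ h in F n * {u}, ∫ v in K, f ((h * v) • x) ∂m ∂Measure.count) atTop
      (𝓝 (∫ v in K, S f (u • v • x) ∂m)) := by
    simp only [← integral_folnerAverage_count (hfin _)]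
    exact hS.tendsto_integral_smul (isAveraging_count hfin hne) _ u f x
  have hconv_one := hconv 1
  simp only [Set.singleton_one, mul_one, one_smul] at hconv_one
  exact sub_eq_zero.1 (tendsto_nhds_unique ((hconv g).sub hconv_one) hasymp)

theorem IsMirroredThinRightFolner.apply_smul
    (hF : IsMirroredThinRightFolner θ F) (hS : AveragesTendsto θ F S) (g : G) (f : C(X, ℝ))
    (x : X) : S f (g • x) = S f x := by
  have hcont (u : G) : Continuous fun v : G => S f (u • v • x) := by fun_prop
  have hzero : (fun v : G => S f (g • v • x) - S f ((1 : G) • v • x)) = 0 := by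
    refine eq_zero_of_forall_setIntegral_isCompact_eq_zero (m := Measure.haar)
      ((hcont g).sub (hcont 1)) fun K hK => ?_
    rw [integral_sub ((hcont g).continuousOn.integrableOn_compact hK)
      ((hcont 1).continuousOn.integrableOn_compact hK),
      hF.setIntegral_apply_smul_eq hS _ hK, hF.setIntegral_apply_smul_eq hS _ hK, sub_self]
  simpa [sub_eq_zero] using congrFun hzero 1

end MirroredThin

/-! ### Operators given by invariant measures -/

/-- Contractivity along the line `P v + t (u - P u)` gives a quadratic polynomial in `t` that is
nonnegative and vanishes at `0`, so its linear coefficient is zero. -/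
lemma bilinForm_apply_idempotent {E : Type*} [AddCommGroup E] [Module ℝ E]
    {B : LinearMap.BilinForm ℝ E} (hB : B.IsSymm) {P : E →ₗ[ℝ] E} (hP : ∀ u, P (P u) = P u)
    (hcontr : ∀ u, B (P u) (P u) ≤ B u u) (u v : E) : B u (P v) = B (P u) (P v) := by
  set w := u - P u with hw
  have hPw : P w = 0 := by rw [hw, map_sub, hP, sub_self]
  have hquad (t : ℝ) : 0 ≤ B w w * (t * t) + 2 * B w (P v) * t + 0 := by
    have hexpand : B (P v + t • w) (P v + t • w) =
        B (P v) (P v) + (B w w * (t * t) + 2 * B w (P v) * t) := by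
      simp only [map_add, map_smul, LinearMap.add_apply, LinearMap.smul_apply, smul_eq_mul,
        hB.eq (P v) w]
      ring
    have hle := hcontr (P v + t • w)
    rw [hexpand, map_add, map_smul, hP, hPw, smul_zero, add_zero] at hle
    linarith
  have hdiscrim := discrim_le_zero hquad
  have hzero : B w (P v) = 0 := by
    rw [discrim] at hdiscrim
    nlinarith [sq_nonneg (B w (P v))]
  rwa [hw, map_sub, LinearMap.sub_apply, sub_eq_zero] at hzero

section Integral

variable {X : Type*} [TopologicalSpace X] [CompactSpace X] [MeasurableSpace X] [BorelSpace X]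

/-- The symmetric bilinear form `(f, k) ↦ ∫ f k dν` on `C(X)`. -/
noncomputable def integralForm (ν : Measure X) [IsFiniteMeasure ν] :
    LinearMap.BilinForm ℝ C(X, ℝ) :=
  LinearMap.mk₂ ℝ (fun f k => ∫ y, (f * k) y ∂ν)
    (fun f₁ f₂ k => by
      rw [add_mul]
      exact integral_add (integrable_continuousMap ν (f₁ * k))
        (integrable_continuousMap ν (f₂ * k)))
    (fun c f k => by
      rw [smul_mul_assoc]
      exact integral_const_mul c _)
    (fun f k₁ k₂ => by
      rw [mul_add]
      exact integral_add (integrable_continuousMap ν (f * k₁))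
        (integrable_continuousMap ν (f * k₂)))
    (fun c f k => by
      rw [mul_smul_comm]
      exact integral_const_mul c _)

lemma integralForm_apply (ν : Measure X) [IsFiniteMeasure ν] (f k : C(X, ℝ)) :
    integralForm ν f k = ∫ y, (f * k) y ∂ν := rfl

lemma isSymm_integralForm (ν : Measure X) [IsFiniteMeasure ν] : (integralForm ν).IsSymm :=
  ⟨fun f k => by simp only [integralForm_apply, mul_comm]⟩

lemma ae_eq_zero_of_integralForm_self {ν : Measure X} [IsFiniteMeasure ν] {f : C(X, ℝ)}
    (hf : integralForm ν f f = 0) : f =ᵐ[ν] 0 := by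
  have hnonneg : 0 ≤ fun y => (f * f) y := fun y => mul_self_nonneg (f y)
  filter_upwards [(integral_eq_zero_iff_of_nonneg hnonneg
    (integrable_continuousMap ν (f * f))).1 hf] with y hy
  exact mul_self_eq_zero.1 hy

lemma integralForm_sub_integral_self (ρ : Measure X) [IsProbabilityMeasure ρ] (f : C(X, ℝ)) :
    integralForm ρ (f - (∫ y, f y ∂ρ) • 1) (f - (∫ y, f y ∂ρ) • 1) =
      ∫ y, (f * f) y ∂ρ - (∫ y, f y ∂ρ) * ∫ y, f y ∂ρ := by
  simp only [map_sub, map_smul, LinearMap.sub_apply, LinearMap.smul_apply, integralForm_apply,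
    one_mul, mul_one, smul_eq_mul, ContinuousMap.one_apply, integral_const, probReal_univ]
  ring

lemma mul_self_integral_le (ρ : Measure X) [IsProbabilityMeasure ρ] (f : C(X, ℝ)) :
    (∫ y, f y ∂ρ) * ∫ y, f y ∂ρ ≤ ∫ y, (f * f) y ∂ρ := by
  rw [← sub_nonneg, ← integralForm_sub_integral_self]
  exact integral_nonneg fun y => mul_self_nonneg _

lemma ae_eq_integral_of_integral_mul_self {ρ : Measure X} [IsProbabilityMeasure ρ] {f : C(X, ℝ)}
    (hf : ∫ y, (f * f) y ∂ρ = (∫ y, f y ∂ρ) * ∫ y, f y ∂ρ) : ∀ᵐ z ∂ρ, f z = ∫ y, f y ∂ρ := by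
  filter_upwards [ae_eq_zero_of_integralForm_self
    ((integralForm_sub_integral_self ρ f).trans (sub_eq_zero.2 hf))] with z hz
  simpa [sub_eq_zero] using hz

end Integral

section Ergodic

variable {G α : Type*} [MeasurableSpace α] {ν : Measure α}

lemma exists_ae_eq_const_of_forall_smul_ae_eq [SMul G α] [ErgodicSMul G α ν] {φ : α → ℝ}
    (hφ : Measurable φ) (h : ∀ g : G, ∀ᵐ y ∂ν, φ (g • y) = φ y) : ∃ c, ∀ᵐ y ∂ν, φ y = c :=
  exists_eventuallyEq_const_of_forall_separating MeasurableSet fun U hU =>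
    eventuallyConst_set.1 <| aeconst_of_forall_preimage_smul_ae_eq G (hφ hU).nullMeasurableSet
      fun g => (h g).mono fun y hy => by
        change (φ (g • y) ∈ U) = (φ y ∈ U)
        rw [hy]

lemma smulInvariantMeasure_restrict [Group G] [MulAction G α] [MeasurableConstSMul G α]
    [SMulInvariantMeasure G α ν] {s : Set α} (hs : MeasurableSet s)
    (hinv : ∀ g : G, (g • ·) ⁻¹' s =ᵐ[ν] s) : SMulInvariantMeasure G α (ν.restrict s) := by
  refine ⟨fun g t ht => ?_⟩
  rw [Measure.restrict_apply (measurable_const_smul g ht), Measure.restrict_apply ht,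
    ← measure_preimage_smul_of_nullMeasurableSet (c := g) (ht.inter hs).nullMeasurableSet]
  exact measure_congr ((ae_eq_refl _).inter (hinv g).symm)

end Ergodic

/-- The operator `S` is given by the `G`-invariant probability measures `μ x`, and it preserves
the integral with respect to every finite invariant measure. -/
structure IsInvariantKernel (G : Type*) {X : Type*} [Group G] [TopologicalSpace X]
    [MeasurableSpace X] [OpensMeasurableSpace X] [MulAction G X] (S : C(X, ℝ) →L[ℝ] C(X, ℝ))
    (μ : X → ProbabilityMeasure X) : Prop where
  isRepresentedBy : IsRepresentedBy S μ
  invariant : ∀ x, SMulInvariantMeasure G X (μ x : Measure X)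
  integral_eq : ∀ (ν : Measure X) [IsFiniteMeasure ν] [SMulInvariantMeasure G X ν] (f : C(X, ℝ)),
    ∫ y, S f y ∂ν = ∫ y, f y ∂ν

section Kernel

variable {G X : Type*} [Group G] [TopologicalSpace X] [MeasurableSpace X] [MulAction G X]
  {S : C(X, ℝ) →L[ℝ] C(X, ℝ)} {μ : X → ProbabilityMeasure X}

lemma integral_eq_of_measure_compl_orbit (hS : ∀ (g : G) (f : C(X, ℝ)) (x : X), S f (g • x) = S f x)
    {x : X} {ν : Measure X} [IsProbabilityMeasure ν]
    (hν : ν (closure (MulAction.orbit G x))ᶜ = 0) (f : C(X, ℝ)) : ∫ y, S f y ∂ν = S f x := by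
  have hsub : closure (MulAction.orbit G x) ⊆ {y | S f y = S f x} :=
    closure_minimal (Set.range_subset_iff.2 fun g => hS g f x)
      (isClosed_eq (S f).continuous continuous_const)
  have hae : ∀ᵐ y ∂ν, S f y = S f x := measure_mono_null (Set.compl_subset_compl.2 hsub) hν
  rw [integral_congr_ae hae, integral_const, probReal_univ, one_smul]

namespace IsInvariantKernel

variable [BorelSpace X]

theorem idempotent (h : IsInvariantKernel G S μ) (f : C(X, ℝ)) : S (S f) = S f := by
  ext x
  have := h.invariant x
  rw [h.isRepresentedBy, h.integral_eq, ← h.isRepresentedBy]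

section HasOuterApproxClosed

variable [HasOuterApproxClosed X]

lemma restrict_eq_smul_of_ae_const (h : IsInvariantKernel G S μ) {x : X}
    (hconst : ∀ k : C(X, ℝ), ∀ᵐ y ∂(μ x : Measure X), S k y = S k x) {s : Set X}
    [SMulInvariantMeasure G X ((μ x : Measure X).restrict s)] :
    (μ x : Measure X).restrict s = (μ x : Measure X) s • (μ x : Measure X) := by
  have := Measure.smul_finite (μ x : Measure X) (measure_ne_top (μ x : Measure X) s)
  refine measure_eq_of_forall_integral_eq fun f => ?_
  calc ∫ y in s, f y ∂(μ x : Measure X) = ∫ y in s, S f y ∂(μ x : Measure X) :=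
        (h.integral_eq _ f).symm
    _ = ∫ _ in s, S f x ∂(μ x : Measure X) := integral_congr_ae (ae_restrict_of_ae (hconst f))
    _ = ∫ y, f y ∂((μ x : Measure X) s • (μ x : Measure X)) := by
        rw [integral_smul_measure, ← h.isRepresentedBy, setIntegral_const]
        rfl

variable [TopologicalSpace G] [ContinuousSMul G X]

lemma apply_koopman (h : IsInvariantKernel G S μ) (g : G) (f : C(X, ℝ)) :
    S (koopman g f) = S f := by
  ext x
  rw [h.isRepresentedBy, h.isRepresentedBy]
  exact (smulInvariantMeasure_iff_integral_koopman _).1 (h.invariant x) g f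

theorem koopman_iff_uniquelyErgodic (h : IsInvariantKernel G S μ)
    (hsupp : ∀ x, (μ x : Measure X) (closure (MulAction.orbit G x))ᶜ = 0) :
    (∀ (g : G) (f : C(X, ℝ)), koopman g (S f) = S f) ↔
      ∀ x : X, IsUniquelyErgodicOrbitClosure G x := by
  refine ⟨fun hk x => ⟨μ x, ⟨h.invariant x, hsupp x⟩, fun ν ⟨hνinv, hν⟩ => ?_⟩, fun hu g f => ?_⟩
  · refine ProbabilityMeasure.toMeasure_injective (measure_eq_of_forall_integral_eq fun f => ?_)
    calc ∫ y, f y ∂(ν : Measure X) = ∫ y, S f y ∂(ν : Measure X) := (h.integral_eq _ f).symm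
      _ = S f x := integral_eq_of_measure_compl_orbit
          (fun g f y => DFunLike.congr_fun (hk g f) y) hν f
      _ = ∫ y, f y ∂(μ x : Measure X) := h.isRepresentedBy f x
  · ext x
    have hμ : μ (g • x) = μ x := (hu x).unique
      ⟨h.invariant _, by simpa only [MulAction.orbit_smul] using hsupp (g • x)⟩
      ⟨h.invariant x, hsupp x⟩
    rw [koopman_apply, h.isRepresentedBy, h.isRepresentedBy, hμ]

end HasOuterApproxClosed

variable [CompactSpace X]

lemma integralForm_self_le (h : IsInvariantKernel G S μ) (ν : Measure X) [IsFiniteMeasure ν]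
    [SMulInvariantMeasure G X ν] (f : C(X, ℝ)) :
    integralForm ν (S f) (S f) ≤ integralForm ν f f := by
  simp only [integralForm_apply]
  rw [← h.integral_eq ν (f * f)]
  refine integral_mono (integrable_continuousMap ν _) (integrable_continuousMap ν _) fun y => ?_
  rw [ContinuousMap.mul_apply, h.isRepresentedBy, h.isRepresentedBy]
  exact mul_self_integral_le _ f

lemma integralForm_apply_right (h : IsInvariantKernel G S μ) (ν : Measure X) [IsFiniteMeasure ν]
    [SMulInvariantMeasure G X ν] (f k : C(X, ℝ)) :
    integralForm ν f (S k) = integralForm ν (S f) (S k) :=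
  bilinForm_apply_idempotent (isSymm_integralForm ν) (P := S.toLinearMap) h.idempotent
    (h.integralForm_self_le ν) f k

theorem seever (h : IsInvariantKernel G S μ) (f k : C(X, ℝ)) : S (f * S k) = S (S f * S k) := by
  ext x
  have := h.invariant x
  rw [h.isRepresentedBy, h.isRepresentedBy]
  exact h.integralForm_apply_right _ f k

lemma averaging_iff_ae_const (h : IsInvariantKernel G S μ) :
    (∀ f k : C(X, ℝ), S (f * S k) = S f * S k) ↔
      ∀ (x : X) (k : C(X, ℝ)), ∀ᵐ y ∂(μ x : Measure X), S k y = S k x := by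
  refine ⟨fun hav x k => ?_, fun hconst f k => ?_⟩
  · have hmean : ∫ y, S k y ∂(μ x : Measure X) = S k x := by
      rw [← h.isRepresentedBy, h.idempotent]
    have hsq : ∫ y, (S k * S k) y ∂(μ x : Measure X) = S k x * S k x := by
      rw [← h.isRepresentedBy, hav, h.idempotent, ContinuousMap.mul_apply]
    rw [← hmean] at hsq ⊢
    exact ae_eq_integral_of_integral_mul_self hsq
  · ext x
    rw [ContinuousMap.mul_apply, h.isRepresentedBy, h.isRepresentedBy f, ← integral_mul_const]
    exact integral_congr_ae ((hconst x k).mono fun y hy => congrArg (f y * ·) hy)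

variable [HasOuterApproxClosed X] [TopologicalSpace G] [ContinuousSMul G X]

lemma integralForm_koopman_right (h : IsInvariantKernel G S μ) (ν : Measure X)
    [IsFiniteMeasure ν] [SMulInvariantMeasure G X ν] (g : G) (f k : C(X, ℝ)) :
    integralForm ν f (koopman g (S k)) = integralForm ν f (S k) := by
  have hshift : f * koopman g (S k) = koopman g (koopman g⁻¹ f * S k) := by
    ext y
    simp
  calc integralForm ν f (koopman g (S k))
      = integralForm ν (koopman g⁻¹ f) (S k) := by
        rw [integralForm_apply, hshift]
        exact (smulInvariantMeasure_iff_integral_koopman ν).1 inferInstance g _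
    _ = integralForm ν f (S k) := by
        rw [h.integralForm_apply_right, h.apply_koopman, ← h.integralForm_apply_right]

lemma ae_apply_smul_eq (h : IsInvariantKernel G S μ) (ν : Measure X) [IsFiniteMeasure ν]
    [SMulInvariantMeasure G X ν] (g : G) (k : C(X, ℝ)) : ∀ᵐ y ∂ν, S k (g • y) = S k y := by
  have hzero (f : C(X, ℝ)) : integralForm ν f (koopman g (S k) - S k) = 0 := by
    rw [map_sub, h.integralForm_koopman_right, sub_self]
  filter_upwards [ae_eq_zero_of_integralForm_self (hzero _)] with y hy
  exact sub_eq_zero.1 hy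

theorem ergodic_iff_ae_const (h : IsInvariantKernel G S μ) (x : X) :
    ErgodicSMul G X (μ x : Measure X) ↔
      ∀ k : C(X, ℝ), ∀ᵐ y ∂(μ x : Measure X), S k y = S k x := by
  have hinv := h.invariant x
  refine ⟨fun _ k => ?_, fun hconst => ⟨fun {s} hs hsinv => ?_⟩⟩
  · obtain ⟨c, hc⟩ := exists_ae_eq_const_of_forall_smul_ae_eq (S k).continuous.measurable
      fun g : G => h.ae_apply_smul_eq (μ x : Measure X) g k
    have hcx : S k x = c := by
      rw [← h.idempotent, h.isRepresentedBy, integral_congr_ae hc, integral_const, probReal_univ,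
        one_smul]
    rwa [hcx]
  · have := smulInvariantMeasure_restrict hs hsinv
    have hsq : (μ x : Measure X) (s ∩ s) = (μ x : Measure X) s * (μ x : Measure X) s := by
      rw [← Measure.restrict_apply hs, h.restrict_eq_smul_of_ae_const hconst]
      rfl
    have hself := (ProbabilityTheory.indepSet_iff_measure_inter_eq_mul hs hs _).2 hsq
    rcases ProbabilityTheory.measure_eq_zero_or_one_of_indepSet_self hself with h0 | h1
    · exact eventuallyConst_set.2 (.inr (measure_eq_zero_iff_ae_notMem.1 h0))
    · exact eventuallyConst_set.2 (.inl ((mem_ae_iff_prob_eq_one hs).2 h1))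

theorem averaging_iff_ergodic (h : IsInvariantKernel G S μ) :
    (∀ f k : C(X, ℝ), S (f * S k) = S f * S k) ↔ ∀ x, ErgodicSMul G X (μ x : Measure X) :=
  h.averaging_iff_ae_const.trans (forall_congr' fun x => (h.ergodic_iff_ae_const x).symm)

end IsInvariantKernel

end Kernel

/-! ### Invariance of the limit operator -/

theorem exists_invariant_of_isAmenable {G X : Type*} [Group G] [TopologicalSpace G]
    [IsTopologicalGroup G] [MetricSpace X] [CompactSpace X] [MeasurableSpace X] [BorelSpace X]
    [MulAction G X] [ContinuousSMul G X] (hG : IsAmenable G) (x : X) :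
    ∃ ν : ProbabilityMeasure X, SMulInvariantMeasure G X (ν : Measure X) ∧
      (ν : Measure X) (closure (MulAction.orbit G x))ᶜ = 0 := by
  obtain ⟨m, hpos, hone, hinv⟩ := hG
  let pull : C(X, ℝ) →ₗ[ℝ] (G →ᵇ ℝ) :=
    { toFun := fun f => orbitFunction f x
      map_add' := fun _ _ => rfl
      map_smul' := fun _ _ => rfl }
  obtain ⟨ν, hν⟩ := exists_probabilityMeasure_of_nonneg (m.comp pull)
    (fun f hf => hpos _ fun h => hf (h • x)) hone
  refine ⟨ν, (smulInvariantMeasure_iff_integral_koopman _).2 fun g f => ?_, ?_⟩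
  · have htrans : orbitFunction (koopman g f) x =
        (orbitFunction f x).compContinuous ⟨fun h => g * h, continuous_const_mul g⟩ := by
      ext h
      exact congrArg f (mul_smul g h x).symm
    rw [hν, hν]
    exact (congrArg m htrans).trans (hinv _ (isRightUniformlyContinuous_orbitFunction f x) g)
  · refine measure_compl_eq_zero_of_forall_integral_eq_zero isClosed_closure
      ⟨x, subset_closure (MulAction.mem_orbit_self x)⟩ fun f hf => ?_
    have hzero : pull f = 0 := by
      ext h
      exact hf _ (subset_closure (MulAction.mem_orbit x h))
    rw [hν, LinearMap.comp_apply, hzero, map_zero]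

section Folner

variable {G X : Type*} [Group G] [MetricSpace X] [CompactSpace X] [MulAction G X]
  [MeasurableSpace G] {θ : Measure G} {F : ℕ → Set G} {S : C(X, ℝ) →L[ℝ] C(X, ℝ)}

lemma AveragesTendsto.apply_smul_of_tendsto (hS : AveragesTendsto θ F S)
    (hr : ∀ (g : G) (f : C(X, ℝ)) (x : X), Tendsto (fun n =>
      folnerAverage θ F n f (g • x) - folnerAverage θ F n f x) atTop (𝓝 0))
    (g : G) (f : C(X, ℝ)) (x : X) : S f (g • x) = S f x :=
  sub_eq_zero.1 (tendsto_nhds_unique ((hS f (g • x)).sub (hS f x)) (hr g f x))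

variable [MeasurableSpace X] [BorelSpace X] {μ : X → ProbabilityMeasure X}

lemma AveragesTendsto.measure_compl_orbit (hS : AveragesTendsto θ F S)
    (hμ : IsRepresentedBy S μ) (x : X) :
    (μ x : Measure X) (closure (MulAction.orbit G x))ᶜ = 0 := by
  refine measure_compl_eq_zero_of_forall_integral_eq_zero isClosed_closure
    ⟨x, subset_closure (MulAction.mem_orbit_self x)⟩ fun f hf => ?_
  have hzero (g : G) : f (g • x) = 0 := hf _ (subset_closure (MulAction.mem_orbit x g))
  rw [← hμ]
  refine tendsto_nhds_unique (hS f x) (tendsto_const_nhds.congr fun n => ?_)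
  simp only [folnerAverage, hzero, integral_zero, mul_zero]

variable [TopologicalSpace G] [ContinuousSMul G X]

lemma AveragesTendsto.invariant_of_left (hS : AveragesTendsto θ F S)
    (hμ : IsRepresentedBy S μ)
    (hl : ∀ (g : G) (f : C(X, ℝ)) (x : X), Tendsto (fun n =>
      folnerAverage θ F n (koopman g f) x - folnerAverage θ F n f x) atTop (𝓝 0)) (x : X) :
    SMulInvariantMeasure G X (μ x : Measure X) :=
  (smulInvariantMeasure_iff_integral_koopman _).2 fun g f => by
    rw [← hμ, ← hμ]
    exact sub_eq_zero.1 (tendsto_nhds_unique ((hS (koopman g f) x).sub (hS f x)) (hl g f x))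

variable [IsTopologicalGroup G] [BorelSpace G]

/-- The operator `S` is constant on orbit closures and preserves the integral of an invariant
measure on the orbit closure of `x`, hence that measure is `μ x`. -/
lemma AveragesTendsto.invariant_of_right (hS : AveragesTendsto θ F S) (hF : IsAveraging θ F)
    (hG : IsAmenable G) (hμ : IsRepresentedBy S μ)
    (hr : ∀ (g : G) (f : C(X, ℝ)) (x : X), S f (g • x) = S f x) (x : X) :
    SMulInvariantMeasure G X (μ x : Measure X) := by
  obtain ⟨ν, hinv, hsupp⟩ := exists_invariant_of_isAmenable hG x
  have hμν : (μ x : Measure X) = ν := measure_eq_of_forall_integral_eq fun f => by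
    rw [← hμ, ← hS.integral_eq hF (ν : Measure X) f]
    exact (integral_eq_of_measure_compl_orbit hr hsupp f).symm
  rwa [hμν]

end Folner

section Comp

variable {G : Type*} [Group G] [TopologicalSpace G] [MeasurableSpace G] {θ : Measure G}
  {F : ℕ → Set G} {φ : ℕ → ℕ}

lemma IsThinLeftFolner.comp (hF : IsThinLeftFolner θ F) (hφ : StrictMono φ) :
    IsThinLeftFolner θ (F ∘ φ) where
  count := hF.count
  finite n := hF.finite (φ n)
  nonempty n := hF.nonempty (φ n)
  tendsto g V hV h1 := (hF.tendsto g V hV h1).comp hφ.tendsto_atTop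

lemma IsThinRightFolner.comp (hF : IsThinRightFolner θ F) (hφ : StrictMono φ) :
    IsThinRightFolner θ (F ∘ φ) where
  count := hF.count
  finite n := hF.finite (φ n)
  nonempty n := hF.nonempty (φ n)
  tendsto g V hV h1 := (hF.tendsto g V hV h1).comp hφ.tendsto_atTop

lemma IsMirroredThinRightFolner.comp (hF : IsMirroredThinRightFolner θ F) (hφ : StrictMono φ) :
    IsMirroredThinRightFolner θ (F ∘ φ) where
  count := hF.count
  finite n := hF.finite (φ n)
  nonempty n := hF.nonempty (φ n)
  tendsto g V hV h1 := (hF.tendsto g V hV h1).comp hφ.tendsto_atTop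

variable [BorelSpace G]

lemma IsFolner.isAveraging [T2Space G] (hF : IsFolner θ F) : IsAveraging θ F := by
  rcases hF with hF | hF | ⟨rfl, hfin, hne, -⟩ | ⟨rfl, hfin, hne, -⟩ | ⟨rfl, hfin, hne, -⟩
  · exact hF.isAveraging
  · exact hF.isAveraging
  all_goals exact isAveraging_count hfin hne

lemma IsThickLeftFolner.comp (hF : IsThickLeftFolner θ F) (hφ : StrictMono φ) :
    IsThickLeftFolner θ (F ∘ φ) where
  __ := hF
  isCompact n := hF.isCompact (φ n)
  nonempty n := hF.nonempty (φ n)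
  pos n := hF.pos (φ n)
  tendsto K hK hne := (hF.tendsto K hK hne).comp hφ.tendsto_atTop

lemma IsThickRightFolner.comp (hF : IsThickRightFolner θ F) (hφ : StrictMono φ) :
    IsThickRightFolner θ (F ∘ φ) where
  __ := hF
  isCompact n := hF.isCompact (φ n)
  nonempty n := hF.nonempty (φ n)
  pos n := hF.pos (φ n)
  tendsto K hK hne := (hF.tendsto K hK hne).comp hφ.tendsto_atTop

lemma IsAdmissibleFolner.comp (hF : IsAdmissibleFolner θ F) (hφ : StrictMono φ) :
    IsAdmissibleFolner θ (F ∘ φ) :=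
  hF.imp (·.comp hφ) <| .imp (·.comp hφ) <| .imp (·.comp hφ) <| .imp (·.comp hφ) <|
    .imp_left (·.comp hφ)

end Comp

theorem IsAdmissibleFolner.isInvariantKernel {G X : Type*}
    [Group G] [TopologicalSpace G] [IsTopologicalGroup G] [T2Space G]
    [MeasurableSpace G] [BorelSpace G]
    [MetricSpace X] [CompactSpace X] [MeasurableSpace X] [BorelSpace X]
    [MulAction G X] [ContinuousSMul G X] {θ : Measure G} {F : ℕ → Set G}
    {S : C(X, ℝ) →L[ℝ] C(X, ℝ)} {μ : X → ProbabilityMeasure X}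
    (hF : IsAdmissibleFolner θ F) (hG : IsAmenable G) (hav : IsAveraging θ F)
    (hS : AveragesTendsto θ F S) (hμ : IsRepresentedBy S μ) : IsInvariantKernel G S μ := by
  refine ⟨hμ, ?_, fun ν _ _ f => hS.integral_eq hav ν f⟩
  rcases hF with hF | hF | hF | hF | ⟨hF, _⟩
  · exact hS.invariant_of_left hμ hF.tendsto_koopman_sub
  · exact hS.invariant_of_right hav hG hμ (hS.apply_smul_of_tendsto hF.tendsto_smul_sub)
  · exact hS.invariant_of_left hμ hF.tendsto_koopman_sub
  · exact hS.invariant_of_right hav hG hμ (hS.apply_smul_of_tendsto hF.tendsto_smul_sub)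
  · exact hS.invariant_of_right hav hG hμ (hF.apply_smul hS)

end FolnerAverages

open FolnerAverages in
theorem theorem3p15 {G X : Type*}
    [Group G] [TopologicalSpace G] [IsTopologicalGroup G] [T2Space G]
    [MeasurableSpace G] [BorelSpace G]
    [MetricSpace X] [CompactSpace X] [MeasurableSpace X] [BorelSpace X]
    [MulAction G X] [ContinuousSMul G X]
    (hG : IsAmenable G) (θ : Measure G) (F : ℕ → Set G) (hF : IsFolner θ F) :
    (IsWeaklyMeanEquicontinuous X θ F →
      ∃ (φ : ℕ → ℕ) (S : C(X, ℝ) →L[ℝ] C(X, ℝ)),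
        StrictMono φ ∧ AveragesTendsto θ (F ∘ φ) S) ∧
    (∀ (φ : ℕ → ℕ) (S : C(X, ℝ) →L[ℝ] C(X, ℝ)),
      StrictMono φ → AveragesTendsto θ (F ∘ φ) S →
        IsWeaklyMeanEquicontinuous X θ (F ∘ φ) ∧
        (∀ f : C(X, ℝ), 0 ≤ f → 0 ≤ S f) ∧ S 1 ≤ 1 ∧ ‖S‖ ≤ 1 ∧
        ∃ μ : X → ProbabilityMeasure X,
          Continuous μ ∧
          (∀ x, IsGeneric θ (F ∘ φ) x (μ x : Measure X)) ∧
          (∀ (f : C(X, ℝ)) (x : X), S f x = ∫ y, f y ∂(μ x : Measure X)) ∧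
          (IsAdmissibleFolner θ F →
            (∀ f : C(X, ℝ), S (S f) = S f) ∧
            (∀ f h : C(X, ℝ), S (f * S h) = S (S f * S h)) ∧
            ((∀ f h : C(X, ℝ), S (f * S h) = S f * S h) ↔
              ∀ x, ErgodicSMul G X (μ x : Measure X)) ∧
            ((∀ (g : G) (f : C(X, ℝ)), koopman g (S f) = S f) ↔
              ∀ x : X, IsUniquelyErgodicOrbitClosure G x))) := by
  have hav := hF.isAveraging
  refine ⟨exists_subseq_averagesTendsto hav, fun φ S hφ hS => ?_⟩
  have havφ := hav.comp φ
  obtain ⟨μ, hμc, hμ⟩ := hS.exists_isRepresentedBy havφ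
  refine ⟨hS.isWeaklyMeanEquicontinuous havφ hμc hμ, fun f hf => hS.nonneg hf,
    (hS.map_one havφ).le, hS.norm_le_one havφ, μ, hμc, fun x f => hμ f x ▸ hS f x, hμ,
    fun hadm => ?_⟩
  have hker := (hadm.comp hφ).isInvariantKernel hG havφ hS hμ
  exact ⟨hker.idempotent, hker.seever, hker.averaging_iff_ergodic,
    hker.koopman_iff_uniquelyErgodic (hS.measure_compl_orbit hμ)⟩
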